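/- Let $d_k(n)$ denote the number of ways of writing $n$ as an ordered product of $k$ positive integers, let $c_q(n)=\sum_{1\le a\le q,\ (a,q)=1}e^{2\pi i an/q}$ be the Ramanujan sum, and let $\phi$ be Euler's function. For every integer $k\ge 2$ and every $\delta>0$ there exist constants $c_{k,\delta}>0$ and $C_{k,\delta}>0$, depending only on $k$ and $\delta$, such that the following holds. Let $0<\epsilon\le \frac12$, and let $\Phi:\mathbb R\to\mathbb R$ be an infinitely differentiable function supported in $[0,1]$ with $0\le\Phi(t)\le 1$ for $0\le t\le 1$ and $\int_0^1\Phi(t)\,dt\ge 1-\epsilon$. Then for all natural numbers $N$ that are sufficiently large (in terms of $k$, $\delta$ and the fixed function $\Phi$), and for every squarefree $q\le N^{\frac12-\frac{\delta}{2}}$ all of whose prime factors are less than $N^{c_{k,\delta}}$, $$\Big|\sum_{n\le N}d_k(n)\,\Phi\Big(\frac nN\Big)\,c_q(n)\Big|\ \ge\ C_{k,\delta}\; d_{k-1}(q)\Big(\frac{\phi(q)}{q}\Big)^{k}N(\log N)^{k-1}.$$ -/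

import Mathlib

open scoped ContDiff

noncomputable section

/-- The `k`-divisor function `d_k(n)`: the number of `k`-tuples of natural numbers with
product `n` (for `n ≥ 1`). -/
def divisorFn (k n : ℕ) : ℕ := (Nat.finMulAntidiag k n).card

/-- The Ramanujan sum `c_q(n) = ∑_{a mod q, (a,q)=1} e(an/q)`, with `e(θ) = exp(2πiθ)`. -/
def ramanujanSum (q n : ℕ) : ℂ :=
  ∑ a ∈ (Finset.range q).filter (fun a => Nat.Coprime a q),
    Complex.exp (2 * Real.pi * Complex.I * ((a : ℂ) * (n : ℂ) / (q : ℂ)))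

/-- `Φ` is a smooth approximation from below, with quality `ε`, to the indicator function
of `[0,1]`: it is `C^∞` on the real line, supported in `[0,1]`, takes values in `[0,1]`, and
`∫₀¹ Φ ≥ 1 - ε`. -/
structure IsSmoothCutoff (ε : ℝ) (Φ : ℝ → ℝ) : Prop where
  smooth : ContDiff ℝ ∞ Φ
  support_subset : tsupport Φ ⊆ Set.Icc 0 1
  nonneg : ∀ t ∈ Set.Icc (0 : ℝ) 1, 0 ≤ Φ t
  le_one : ∀ t ∈ Set.Icc (0 : ℝ) 1, Φ t ≤ 1
  integral_ge : 1 - ε ≤ ∫ t in (0 : ℝ)..1, Φ t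

end

open Real MeasureTheory Set Filter Topology

/-! For squarefree `q`, `c_q(n)` is the product over `p ∣ q` of `p·1_{p∣n} - 1 = (p - 1) -
p·1_{p∤n}`. So `d_k(n) c_q(n)` has Dirichlet series `ζ(s)^k ∏_{p∣q} ((p - 1) - p (1 - p⁻ˢ)^k)`. The
argument exploits this factorization with real-variable tools only. Throughout, `m = k - 1` and `L =
log N`.

Without `c_q`, the hyperbola method and partial summation give `x Q(log x) + O(x^(1-η))`, with `deg
Q ≤ m` and the coefficient of degree `m` bounded below independently of `Φ`
(`exists_smooth_summatory_zetaPow_asymptotic`). Each prime of `q` then acts on functions of `x`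
through `localOp`, a combination of the dilations `x ↦ x / p^j`. Since `Q(log x)` is `Q(d/du) e^{u
log x}` at `u = 0`, this action multiplies `e^{u log x}` by `H_p(u log p)`, where `H_p(u) = (p - 1)
- p (1 - e^{-u}/p)^k`. The error grows by at most `1 + 2^k p^η` per prime
(`abs_summatory_ramanujanProd_sub_le`), which is harmless because `q ≤ N^(1/2)`.

It remains to bound below the coefficient of `u^m` in `e^{uL} ∏ H_p(u log p)`. Write `H_p(u) = h_p
e^{-α_p u} (1 + E_p(u))` with `E_p = O(u²)` and `0 ≤ α_p ≤ 2`. The exponentials combine to `e^{u(L -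
∑ α_p log p)}`, and `∑ α_p log p ≤ 2 log q ≤ (1 - δ) L`, so a rate of at least `δ L` survives; this
is where the exponent `1/2 - δ/2` is needed. On the scale `u ~ 1/L` the factor at `p` differs from
`1` by `O((log p / L)²)`, and `log p ≤ c L` makes the sum of these `O(c)`
(`exists_coeff_prod_localSeries_bounds`). The main term is thus `≫ N L^m ∏ h_p`, and `h_p ≥ m (1 -
1/p)^m` gives the stated arithmetic factor. -/

/-! ### Polynomials in `log x` up to a power saving -/

theorem exists_abs_eval_log_le (P : Polynomial ℝ) {ε : ℝ} (hε : 0 < ε) :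
    ∃ C : ℝ, 0 ≤ C ∧ ∀ x : ℝ, 1 ≤ x → |P.eval (log x)| ≤ C * x ^ ε := by
  induction P using Polynomial.induction_on' with
  | add p q hp hq =>
    obtain ⟨C, hC, h⟩ := hp
    obtain ⟨D, hD, h'⟩ := hq
    refine ⟨C + D, by positivity, fun x hx => ?_⟩
    rw [Polynomial.eval_add, add_mul]
    exact (abs_add_le _ _).trans (add_le_add (h x hx) (h' x hx))
  | monomial n a =>
    have hn : 0 < ε / (n + 1) := by positivity
    refine ⟨|a| * ((ε / (n + 1))⁻¹) ^ n, by positivity, fun x hx => ?_⟩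
    have hx0 : 0 ≤ x := by linarith
    rw [Polynomial.eval_monomial, abs_mul, abs_pow, mul_assoc]
    refine mul_le_mul_of_nonneg_left ?_ (abs_nonneg a)
    rw [abs_of_nonneg (log_nonneg hx)]
    calc log x ^ n ≤ (x ^ (ε / (n + 1)) / (ε / (n + 1))) ^ n :=
          pow_le_pow_left₀ (log_nonneg hx) (log_le_rpow_div hx0 hn) n
      _ = ((ε / (n + 1))⁻¹) ^ n * x ^ (ε / (n + 1) * n) := by
          rw [div_eq_inv_mul, mul_pow, rpow_mul hx0, rpow_natCast]
      _ ≤ _ := by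
          refine mul_le_mul_of_nonneg_left (rpow_le_rpow_of_exponent_le hx ?_) (by positivity)
          rw [div_mul_eq_mul_div, div_le_iff₀ (by positivity)]
          nlinarith

/-- `f` agrees with a polynomial in `log x` up to a power saving, on `[1, ∞)`. -/
def PolyLog (f : ℝ → ℝ) : Prop :=
  ∃ P : Polynomial ℝ, ∃ η : ℝ, 0 < η ∧ ∃ C : ℝ, 0 ≤ C ∧ ∀ x : ℝ, 1 ≤ x →
    |f x - P.eval (log x)| ≤ C * x ^ (-η)

namespace PolyLog

theorem congr {f g : ℝ → ℝ} (hf : PolyLog f) (h : ∀ x, 1 ≤ x → f x = g x) : PolyLog g := by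
  obtain ⟨P, η, hη, C, hC, H⟩ := hf
  exact ⟨P, η, hη, C, hC, fun x hx => h x hx ▸ H x hx⟩

theorem eval_log (P : Polynomial ℝ) : PolyLog fun x => P.eval (log x) :=
  ⟨P, 1, one_pos, 0, le_rfl, fun x hx => by simp⟩

theorem const (c : ℝ) : PolyLog fun _ => c := by
  simpa using eval_log (Polynomial.C c)

theorem log_pow (n : ℕ) : PolyLog fun x => log x ^ n := by
  simpa using eval_log (Polynomial.X ^ n)

theorem of_bound {f : ℝ → ℝ} {η : ℝ} (hη : 0 < η) (C : ℝ)
    (h : ∀ x, 1 ≤ x → |f x| ≤ C * x ^ (-η)) : PolyLog f := by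
  refine ⟨0, η, hη, |C|, abs_nonneg C, fun x hx => ?_⟩
  have := h x hx
  have h1 : 0 ≤ x ^ (-η) := rpow_nonneg (by linarith) _
  simpa using this.trans (mul_le_mul_of_nonneg_right (le_abs_self C) h1)

theorem bound {f : ℝ → ℝ} (hf : PolyLog f) {ε : ℝ} (hε : 0 < ε) :
    ∃ C, 0 ≤ C ∧ ∀ x, 1 ≤ x → |f x| ≤ C * x ^ ε := by
  obtain ⟨P, η, hη, C, hC, H⟩ := hf
  obtain ⟨D, hD, H'⟩ := exists_abs_eval_log_le P hε
  refine ⟨C + D, by positivity, fun x hx => ?_⟩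
  have h1 : x ^ (-η) ≤ x ^ ε := rpow_le_rpow_of_exponent_le hx (by linarith)
  calc |f x| = |(f x - P.eval (log x)) + P.eval (log x)| := by ring_nf
    _ ≤ C * x ^ ε + D * x ^ ε := (abs_add_le _ _).trans
        (add_le_add ((H x hx).trans (mul_le_mul_of_nonneg_left h1 hC)) (H' x hx))
    _ = _ := by ring

theorem add {f g : ℝ → ℝ} (hf : PolyLog f) (hg : PolyLog g) : PolyLog fun x => f x + g x := by
  obtain ⟨P, η, hη, C, hC, H⟩ := hf
  obtain ⟨Q, θ, hθ, D, hD, H'⟩ := hg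
  refine ⟨P + Q, min η θ, lt_min hη hθ, C + D, by positivity, fun x hx => ?_⟩
  have h1 : x ^ (-η) ≤ x ^ (-min η θ) :=
    rpow_le_rpow_of_exponent_le hx (neg_le_neg (min_le_left _ _))
  have h2 : x ^ (-θ) ≤ x ^ (-min η θ) :=
    rpow_le_rpow_of_exponent_le hx (neg_le_neg (min_le_right _ _))
  calc |f x + g x - (P + Q).eval (log x)|
      = |(f x - P.eval (log x)) + (g x - Q.eval (log x))| := by
        rw [Polynomial.eval_add]; ring_nf
    _ ≤ C * x ^ (-min η θ) + D * x ^ (-min η θ) := (abs_add_le _ _).trans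
        (add_le_add ((H x hx).trans (mul_le_mul_of_nonneg_left h1 hC))
          ((H' x hx).trans (mul_le_mul_of_nonneg_left h2 hD)))
    _ = _ := by ring

/-- From `fg - PQ = (f - P) g + P (g - Q)`: the factor without a saving grows slower than any power,
and is paid for with half of the other factor's saving. -/
theorem mul {f g : ℝ → ℝ} (hf : PolyLog f) (hg : PolyLog g) : PolyLog fun x => f x * g x := by
  have hg0 := hg
  obtain ⟨P, η, hη, C, hC, H⟩ := hf
  obtain ⟨Q, θ, hθ, D, hD, H'⟩ := hg
  obtain ⟨A, hA, hPA⟩ := exists_abs_eval_log_le P (half_pos hθ)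
  obtain ⟨B, hB, hQB⟩ := hg0.bound (half_pos hη)
  have key : PolyLog fun x => f x * g x - (P * Q).eval (log x) := by
    have e1 : PolyLog fun x => (f x - P.eval (log x)) * g x := by
      refine of_bound (half_pos hη) (C * B) fun x hx => ?_
      have hx0 : 0 < x := by linarith
      calc |(f x - P.eval (log x)) * g x| ≤ (C * x ^ (-η)) * (B * x ^ (η / 2)) := by
            rw [abs_mul]
            exact mul_le_mul (H x hx) (hQB x hx) (abs_nonneg _) (by positivity)
        _ = C * B * (x ^ (-η) * x ^ (η / 2)) := by ring
        _ = _ := by rw [← rpow_add hx0]; ring_nf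
    have e2 : PolyLog fun x => P.eval (log x) * (g x - Q.eval (log x)) := by
      refine of_bound (half_pos hθ) (A * D) fun x hx => ?_
      have hx0 : 0 < x := by linarith
      calc |P.eval (log x) * (g x - Q.eval (log x))| ≤ (A * x ^ (θ / 2)) * (D * x ^ (-θ)) := by
            rw [abs_mul]
            exact mul_le_mul (hPA x hx) (H' x hx) (abs_nonneg _) (by positivity)
        _ = A * D * (x ^ (θ / 2) * x ^ (-θ)) := by ring
        _ = _ := by rw [← rpow_add hx0]; ring_nf
    refine (e1.add e2).congr fun x _ => ?_
    rw [Polynomial.eval_mul]; ring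
  exact (key.add (eval_log (P * Q))).congr fun x _ => by ring

theorem const_mul {f : ℝ → ℝ} (c : ℝ) (hf : PolyLog f) : PolyLog fun x => c * f x :=
  (const c).mul hf

theorem neg {f : ℝ → ℝ} (hf : PolyLog f) : PolyLog fun x => -f x :=
  (hf.const_mul (-1)).congr fun x _ => by ring

theorem sub {f g : ℝ → ℝ} (hf : PolyLog f) (hg : PolyLog g) : PolyLog fun x => f x - g x :=
  (hf.add hg.neg).congr fun x _ => by ring

theorem sum {ι : Type*} (s : Finset ι) {f : ι → ℝ → ℝ} (h : ∀ i ∈ s, PolyLog (f i)) :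
    PolyLog fun x => ∑ i ∈ s, f i x := by
  classical
  induction s using Finset.induction_on with
  | empty => simpa using const 0
  | insert a s ha ih =>
    refine ((h a (Finset.mem_insert_self a s)).add
      (ih fun i hi => h i (Finset.mem_insert_of_mem hi))).congr fun x _ => ?_
    rw [Finset.sum_insert ha]

theorem comp_sqrt {f : ℝ → ℝ} (hf : PolyLog f) : PolyLog fun x => f (√x) := by
  obtain ⟨P, η, hη, C, hC, H⟩ := hf
  refine ⟨P.comp (Polynomial.C (1 / 2) * Polynomial.X), η / 2, half_pos hη, C, hC, fun x hx => ?_⟩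
  have hx0 : 0 ≤ x := by linarith
  have := H (√x) (one_le_sqrt.2 hx)
  rw [log_sqrt hx0] at this
  convert this using 2
  · simp; ring_nf
  · rw [sqrt_eq_rpow, ← rpow_mul hx0]; ring_nf

theorem exists_antiderivative (P : Polynomial ℝ) :
    ∃ Q : Polynomial ℝ, Polynomial.derivative Q = P ∧ Q.eval 0 = 0 := by
  induction P using Polynomial.induction_on' with
  | add p q hp hq =>
    obtain ⟨A, hA, hA0⟩ := hp
    obtain ⟨B, hB, hB0⟩ := hq
    exact ⟨A + B, by simp [hA, hB], by simp [hA0, hB0]⟩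
  | monomial n a =>
    refine ⟨Polynomial.monomial (n + 1) (a / (n + 1)), ?_, by simp [Polynomial.eval_monomial]⟩
    rw [Polynomial.derivative_monomial]
    have : (n : ℝ) + 1 ≠ 0 := by positivity
    congr 1
    push_cast
    field_simp

/-- Under `t = e^u` the polynomial part integrates to a polynomial. The remainder is `O(t^(-η-1))`,
hence integrable on `(1, ∞)`: its full integral joins the constant term and its tail is the new
error. -/
theorem integral_div {f : ℝ → ℝ} (hf : PolyLog f)
    (hint : ∀ x, 1 ≤ x → IntervalIntegrable (fun t => f t / t) volume 1 x) :
    PolyLog fun x => ∫ t in (1 : ℝ)..x, f t / t := by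
  obtain ⟨P, η, hη, C, hC, H⟩ := hf
  obtain ⟨Q, hQ, hQ0⟩ := exists_antiderivative P
  set E : ℝ → ℝ := fun t => (f t - P.eval (log t)) / t with hE
  have hPint : ∀ x, 1 ≤ x → IntervalIntegrable (fun t => P.eval (log t) / t) volume 1 x := by
    intro x hx
    apply ContinuousOn.intervalIntegrable
    rw [uIcc_of_le hx]
    have h0 : ∀ t ∈ Icc 1 x, t ≠ 0 := fun t ht => by have := ht.1; positivity
    exact (P.continuous.comp_continuousOn (continuousOn_log.mono h0)).div continuousOn_id h0
  have hP : ∀ x, 1 ≤ x → ∫ t in (1 : ℝ)..x, P.eval (log t) / t = Q.eval (log x) := by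
    intro x hx
    rw [intervalIntegral.integral_eq_sub_of_hasDerivAt (f := fun t => Q.eval (log t)) _ (hPint x hx)]
    · simp [hQ0]
    · intro t ht
      rw [uIcc_of_le hx] at ht
      have ht0 : t ≠ 0 := by have := ht.1; positivity
      have := (Q.hasDerivAt (log t)).comp t (hasDerivAt_log ht0)
      rw [hQ] at this
      simpa [div_eq_mul_inv, Function.comp_def] using this
  have hEint : ∀ x, 1 ≤ x → IntervalIntegrable E volume 1 x := by
    intro x hx
    refine ((hint x hx).sub (hPint x hx)).congr ?_
    intro t _
    simp [hE, sub_div]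
  have hEb : ∀ t, 1 ≤ t → |E t| ≤ C * t ^ (-η - 1) := by
    intro t ht
    have ht0 : 0 < t := by linarith
    rw [hE]
    dsimp only
    rw [abs_div, abs_of_pos ht0, div_le_iff₀ ht0, mul_assoc, ← rpow_add_one ht0.ne']
    simpa using H t ht
  have hpow : IntegrableOn (fun t : ℝ => C * t ^ (-η - 1)) (Ioi 1) :=
    (integrableOn_Ioi_rpow_of_lt (by linarith) one_pos).const_mul C
  -- Integrability is only given on bounded intervals, so measurability on the half-line is
  -- assembled from countably many of them.
  have hEmeas : AEStronglyMeasurable E (volume.restrict (Ioi 1)) := by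
    have : Ioi (1 : ℝ) = ⋃ n : ℕ, Ioc (1 : ℝ) (n + 1) := by
      ext t
      simp only [mem_Ioi, mem_iUnion, mem_Ioc]
      refine ⟨fun ht => ?_, fun ⟨n, h, _⟩ => h⟩
      obtain ⟨n, hn⟩ := exists_nat_ge t
      exact ⟨n, ht, by linarith⟩
    rw [this]
    refine AEStronglyMeasurable.iUnion fun n => ?_
    have := hEint (n + 1) (by have : (0:ℝ) ≤ n := n.cast_nonneg; linarith)
    exact this.1.aestronglyMeasurable
  have hEI : IntegrableOn E (Ioi 1) := by
    refine Integrable.mono' hpow hEmeas ?_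
    filter_upwards [ae_restrict_mem measurableSet_Ioi] with t ht
    exact hEb t (le_of_lt ht)
  refine ⟨Q + Polynomial.C (∫ t in Ioi (1 : ℝ), E t), η, hη, C / η, by positivity, fun x hx => ?_⟩
  have hx0 : 0 < x := by linarith
  have e1 : ∫ t in (1 : ℝ)..x, f t / t = Q.eval (log x) + ∫ t in (1 : ℝ)..x, E t := by
    rw [← hP x hx, ← intervalIntegral.integral_add (hPint x hx) (hEint x hx)]
    refine intervalIntegral.integral_congr fun t _ => ?_
    simp only [hE]; ring
  have e2 : (∫ t in (1 : ℝ)..x, E t) + ∫ t in Ioi x, E t = ∫ t in Ioi (1 : ℝ), E t :=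
    intervalIntegral.integral_interval_add_Ioi hEI (hEI.mono_set (Ioi_subset_Ioi hx))
  have e3 : (∫ t in (1 : ℝ)..x, f t / t) -
      (Q + Polynomial.C (∫ t in Ioi (1 : ℝ), E t)).eval (log x) = -∫ t in Ioi x, E t := by
    rw [e1, ← e2]; simp
  rw [e3, abs_neg]
  calc |∫ t in Ioi x, E t| ≤ ∫ t in Ioi x, C * t ^ (-η - 1) := by
        rw [← Real.norm_eq_abs]
        refine norm_integral_le_of_norm_le (hpow.mono_set (Ioi_subset_Ioi hx)) ?_
        filter_upwards [ae_restrict_mem measurableSet_Ioi] with t ht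
        exact hEb t (hx.trans (le_of_lt ht))
    _ = C / η * x ^ (-η) := by
        rw [integral_const_mul, integral_Ioi_rpow_of_lt (by linarith) hx0,
          show -η - 1 + 1 = -η by ring]
        field_simp

end PolyLog

/-! ### Summatory functions and Abel summation -/

/-- The summatory function of `a` over positive integers up to `x`. -/
noncomputable def summatory (a : ℕ → ℝ) (x : ℝ) : ℝ := ∑ n ∈ Finset.Icc 1 ⌊x⌋₊, a n

theorem summatory_eq_sum_Icc_zero {a : ℕ → ℝ} (ha : a 0 = 0) (x : ℝ) :
    ∑ n ∈ Finset.Icc 0 ⌊x⌋₊, a n = summatory a x := by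
  rw [summatory, ← Finset.add_sum_Ioc_eq_sum_Icc (Nat.zero_le _), ha, zero_add]
  rfl

theorem summatory_of_lt_one (a : ℕ → ℝ) {x : ℝ} (hx : x < 1) : summatory a x = 0 := by
  rw [summatory, Nat.floor_eq_zero.2 hx]
  simp

theorem summatory_mul_eq {a : ℕ → ℝ} (ha : a 0 = 0) {f f' : ℝ → ℝ} {x : ℝ} (hx : 1 ≤ x)
    (hf : ∀ t ∈ Icc 1 x, HasDerivAt f (f' t) t) (hf' : ContinuousOn f' (Icc 1 x)) :
    summatory (fun n => f n * a n) x =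
      f x * summatory a x - ∫ t in (1 : ℝ)..x, f' t * summatory a t := by
  have hd : EqOn (deriv f) f' (Icc 1 x) := fun t ht => (hf t ht).deriv
  have := sum_mul_eq_sub_integral_mul₀ a ha x (fun t ht => (hf t ht).differentiableAt)
    ((hf'.congr hd).integrableOn_Icc)
  rw [← summatory_eq_sum_Icc_zero (by simp [ha]) x, this, summatory_eq_sum_Icc_zero ha,
    intervalIntegral.integral_of_le hx]
  congr 1
  refine setIntegral_congr_fun measurableSet_Ioc fun t ht => ?_
  rw [hd (Ioc_subset_Icc_self ht), summatory_eq_sum_Icc_zero ha]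

theorem intervalIntegrable_mul_summatory {a : ℕ → ℝ} (ha : a 0 = 0) {g : ℝ → ℝ} {y x : ℝ}
    (hy : 0 ≤ y) (hx : y ≤ x)
    (hg : ContinuousOn g (Icc y x)) :
    IntervalIntegrable (fun t => g t * summatory a t) volume y x := by
  rw [intervalIntegrable_iff_integrableOn_Icc_of_le hx]
  simpa only [summatory_eq_sum_Icc_zero ha] using
    integrableOn_mul_sum_Icc a (m := 0) hy hg.integrableOn_Icc

/-- Abel summation against `log t ^ j / t`. Its derivative is a polynomial in `log t` over `t²`, so
the integrand is such a polynomial times `summatory a t / t`, divided by `t`, which is the shape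
handled by `integral_div`. -/
theorem PolyLog.summatory_log_pow_div {a : ℕ → ℝ} (ha : a 0 = 0)
    (h : PolyLog fun x => summatory a x / x) (j : ℕ) :
    PolyLog (summatory fun n => log n ^ j / n * a n) := by
  set f' : ℝ → ℝ := fun t => (j * log t ^ (j - 1) - log t ^ j) / t ^ 2
  have hder : ∀ t : ℝ, 1 ≤ t → HasDerivAt (fun t : ℝ => log t ^ j / t) (f' t) t := by
    intro t ht
    have ht0 : t ≠ 0 := by positivity
    convert! ((hasDerivAt_log ht0).pow j).div (hasDerivAt_id t) ht0 using 1
    simp only [f', id, Pi.pow_apply]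
    field_simp
  have h0 : ∀ x : ℝ, ∀ t ∈ Icc 1 x, t ≠ 0 := fun x t ht => by have := ht.1; positivity
  have hlog : ∀ x : ℝ, ContinuousOn log (Icc 1 x) := fun x => continuousOn_log.mono (h0 x)
  have hcont : ∀ x : ℝ, ContinuousOn f' (Icc 1 x) := by
    intro x
    refine ((((hlog x).pow _).const_smul (j : ℝ)).sub ((hlog x).pow _)).div
      (continuousOn_id.pow 2) fun t ht => ?_
    exact pow_ne_zero 2 (h0 x t ht)
  have hint := ((((PolyLog.log_pow (j - 1)).const_mul j).sub (PolyLog.log_pow j)).mul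
    h).integral_div (by
      intro x hx
      refine (intervalIntegrable_mul_summatory ha zero_le_one hx (hcont x)).congr ?_
      intro t ht
      rw [uIoc_of_le hx] at ht
      have ht0 : t ≠ 0 := by have := ht.1; positivity
      simp only [f']
      field_simp)
  refine (((PolyLog.log_pow j).mul h).sub hint).congr fun x hx => ?_
  rw [summatory_mul_eq ha hx (fun t ht => hder t ht.1) (hcont x)]
  congr 1
  · ring
  · refine intervalIntegral.integral_congr fun t ht => ?_
    rw [uIcc_of_le hx] at ht
    have ht0 : t ≠ 0 := by have := ht.1; positivity
    simp only [f']
    field_simp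

theorem PolyLog.floor_div : PolyLog fun x => (⌊x⌋₊ : ℝ) / x := by
  have : PolyLog fun x => (⌊x⌋₊ : ℝ) / x - 1 := by
    refine PolyLog.of_bound one_pos 1 fun x hx => ?_
    have hx0 : 0 < x := by linarith
    have h1 := Nat.floor_le hx0.le
    have h2 := Nat.lt_floor_add_one x
    rw [rpow_neg_one, one_mul, div_sub_one hx0.ne', abs_div, abs_of_pos hx0, div_eq_mul_inv]
    exact mul_le_of_le_one_left (by positivity) (by rw [abs_le]; constructor <;> linarith)
  exact (this.add (PolyLog.const 1)).congr fun x _ => by ring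

theorem PolyLog.sum_log_pow_div (j : ℕ) :
    PolyLog (summatory fun n => log n ^ j / n) := by
  set a : ℕ → ℝ := fun n => if n = 0 then 0 else 1
  have h : PolyLog fun x => summatory a x / x := by
    refine PolyLog.floor_div.congr fun x _ => ?_
    congr 1
    rw [summatory, Finset.sum_congr rfl (g := fun _ => (1 : ℝ))]
    · simp
    · intro n hn
      have := (Finset.mem_Icc.1 hn).1
      simp [a]; omega
  refine (PolyLog.summatory_log_pow_div (a := a) rfl h j).congr fun x _ => ?_
  refine Finset.sum_congr rfl fun n hn => ?_
  have := (Finset.mem_Icc.1 hn).1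
  have h' : n ≠ 0 := by omega
  simp [a, h']

/-- The binomial theorem separates `log x` from `log n`. This is the main term of the first sum in
the hyperbola method. -/
theorem PolyLog.sum_eval_log_sub (P : Polynomial ℝ) :
    PolyLog fun x => summatory (fun n => 1 / n * P.eval (log x - log n)) (√x) := by
  induction P using Polynomial.induction_on' with
  | add p q hp hq =>
    refine (hp.add hq).congr fun x _ => ?_
    simp only [summatory, ← Finset.sum_add_distrib, Polynomial.eval_add, mul_add]
  | monomial m c =>
    have := PolyLog.sum (Finset.range (m + 1)) (f := fun i x =>
      (c * m.choose i * (-1) ^ (m - i)) * (log x ^ i *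
        summatory (fun n => log n ^ (m - i) / n) (√x))) fun i _ =>
      (((PolyLog.log_pow i).mul (PolyLog.sum_log_pow_div (m - i)).comp_sqrt).const_mul _)
    refine this.congr fun x _ => ?_
    simp only [summatory, Finset.mul_sum]
    rw [Finset.sum_comm]
    refine Finset.sum_congr rfl fun n _ => ?_
    rw [Polynomial.eval_monomial, sub_eq_add_neg, add_pow, Finset.mul_sum, Finset.mul_sum]
    refine Finset.sum_congr rfl fun i _ => ?_
    rw [neg_pow]
    ring

/-! ### The Dirichlet hyperbola method -/

/-- A point with `n * m ≤ X` has `n ≤ √X` or `m ≤ √X`, and the square where both hold is counted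
twice. All sums are spread over one box with indicator weights and compared pointwise. -/
theorem sum_Icc_sum_Icc_div_comm (a : ℕ → ℝ) (X : ℕ) :
    ∑ n ∈ Finset.Icc 1 X, ∑ m ∈ Finset.Icc 1 (X / n), a m =
      ∑ n ∈ Finset.Icc 1 X.sqrt, ∑ m ∈ Finset.Icc 1 (X / n), a m +
      ∑ m ∈ Finset.Icc 1 X.sqrt, a m * (X / m : ℕ) -
      X.sqrt * ∑ m ∈ Finset.Icc 1 X.sqrt, a m := by
  set I := Finset.Icc 1 X
  set y := X.sqrt
  have hyX : y ≤ X := Nat.sqrt_le_self X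
  have hin : ∀ n ∈ I, ∑ m ∈ Finset.Icc 1 (X / n), a m =
      ∑ m ∈ I, if n * m ≤ X then a m else 0 := by
    intro n hn
    have hn1 := (Finset.mem_Icc.1 hn).1
    rw [← Finset.sum_filter]
    refine Finset.sum_congr ?_ fun _ _ => rfl
    ext m
    simp only [I, Finset.mem_Icc, Finset.mem_filter, Nat.le_div_iff_mul_le hn1, mul_comm n m]
    constructor
    · rintro ⟨h1, h2⟩
      exact ⟨⟨h1, le_trans (Nat.le_mul_of_pos_right m hn1) h2⟩, h2⟩
    · rintro ⟨⟨h1, _⟩, h2⟩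
      exact ⟨h1, h2⟩
  have hsub : ∀ f : ℕ → ℝ, ∑ n ∈ Finset.Icc 1 y, f n = ∑ n ∈ I, if n ≤ y then f n else 0 := by
    intro f
    rw [← Finset.sum_filter]
    refine Finset.sum_congr ?_ fun _ _ => rfl
    ext n
    simp only [I, Finset.mem_Icc, Finset.mem_filter]
    omega
  have h2 : ∑ m ∈ Finset.Icc 1 y, a m * (X / m : ℕ) =
      ∑ n ∈ I, ∑ m ∈ I, if m ≤ y ∧ n * m ≤ X then a m else 0 := by
    rw [Finset.sum_comm, hsub]
    refine Finset.sum_congr rfl fun m hm => ?_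
    have hm1 := (Finset.mem_Icc.1 hm).1
    split_ifs with h
    · have : (X / m : ℕ) = ((I.filter fun n => n * m ≤ X).card) := by
        have : I.filter (fun n => n * m ≤ X) = Finset.Icc 1 (X / m) := by
          ext n
          simp only [I, Finset.mem_Icc, Finset.mem_filter, Nat.le_div_iff_mul_le hm1]
          constructor
          · rintro ⟨⟨h1, _⟩, h2⟩
            exact ⟨h1, h2⟩
          · rintro ⟨h1, h2⟩
            exact ⟨⟨h1, le_trans (Nat.le_mul_of_pos_right n hm1) h2⟩, h2⟩
        rw [this]; simp
      simp only [h, true_and]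
      rw [← Finset.sum_filter, Finset.sum_const, this, nsmul_eq_mul, mul_comm]
    · simp [h]
  have h3 : (y : ℝ) * ∑ m ∈ Finset.Icc 1 y, a m =
      ∑ n ∈ I, ∑ m ∈ I, if n ≤ y ∧ m ≤ y then a m else 0 := by
    have : (y : ℝ) * ∑ m ∈ Finset.Icc 1 y, a m =
        ∑ n ∈ Finset.Icc 1 y, ∑ m ∈ Finset.Icc 1 y, a m := by simp
    rw [this, hsub]
    refine Finset.sum_congr rfl fun n _ => ?_
    split_ifs with h
    · rw [hsub]; simp [h]
    · simp [h]
  rw [h2, h3, hsub, Finset.sum_congr rfl hin, ← Finset.sum_add_distrib, ← Finset.sum_sub_distrib]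
  refine Finset.sum_congr rfl fun n hn => ?_
  have h4 : (if n ≤ y then ∑ m ∈ Finset.Icc 1 (X / n), a m else 0) =
      ∑ m ∈ I, if n ≤ y ∧ n * m ≤ X then a m else 0 := by
    split_ifs with h
    · rw [hin n hn]; simp [h]
    · simp [h]
  rw [h4, ← Finset.sum_add_distrib, ← Finset.sum_sub_distrib]
  refine Finset.sum_congr rfl fun m hm => ?_
  by_cases hn' : n ≤ y <;> by_cases hm' : m ≤ y
  · have : n * m ≤ X := (Nat.mul_le_mul hn' hm').trans (Nat.sqrt_le X)
    simp [hn', hm', this]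
  · simp [hn', hm']
  · simp [hn', hm']
  · have : ¬ n * m ≤ X := by
      have h5 : X < (y + 1) * (y + 1) := Nat.lt_succ_sqrt X
      have h6 : (y + 1) * (y + 1) ≤ n * m := Nat.mul_le_mul (by omega) (by omega)
      omega
    simp [hn', hm', this]

theorem floor_sqrt_eq {x : ℝ} (hx : 0 ≤ x) : ⌊√x⌋₊ = ⌊x⌋₊.sqrt := by
  refine eq_of_forall_le_iff fun m => ?_
  rw [Nat.le_floor_iff (sqrt_nonneg x), Nat.le_sqrt, Nat.le_floor_iff hx,
    Real.le_sqrt (Nat.cast_nonneg m) hx, sq]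
  push_cast
  rfl

/-! ### Divisor functions and their mean values -/

open ArithmeticFunction in
/-- The `k`-fold divisor function as a real-valued arithmetic function. -/
noncomputable def zetaPow (k : ℕ) : ArithmeticFunction ℝ :=
  ((zeta : ArithmeticFunction ℕ) : ArithmeticFunction ℝ) ^ k

theorem card_finMulAntidiag_succ (k n : ℕ) :
    (Nat.finMulAntidiag (k + 1) n).card =
      ∑ d ∈ n.divisorsAntidiagonal, (Nat.finMulAntidiag k d.2).card := by
  classical
  rcases eq_or_ne n 0 with rfl | hn
  · simp
  rw [← Finset.card_sigma]
  refine Finset.card_bij' (fun f _ => ⟨(f 0, ∏ i : Fin k, f i.succ), Fin.tail f⟩)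
    (fun g _ => Fin.cons g.1.1 g.2) ?_ ?_ ?_ ?_
  · intro f hf
    rw [Nat.mem_finMulAntidiag, Fin.prod_univ_succ] at hf
    have h2 : ∏ i : Fin k, f i.succ ≠ 0 := by
      intro h; rw [h, mul_zero] at hf; exact hf.2 hf.1.symm
    simp [hf.1, hn, Nat.mem_finMulAntidiag, Fin.tail, h2]
  · rintro ⟨⟨a, b⟩, g⟩ hg
    simp only [Finset.mem_sigma, Nat.mem_divisorsAntidiagonal, Nat.mem_finMulAntidiag] at hg
    rw [Nat.mem_finMulAntidiag, Fin.prod_univ_succ]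
    simp [hg.2.1, hg.1.1, hn]
  · intro f _
    exact Fin.cons_self_tail f
  · rintro ⟨⟨a, b⟩, g⟩ hg
    simp only [Finset.mem_sigma, Nat.mem_divisorsAntidiagonal, Nat.mem_finMulAntidiag] at hg
    simp [hg.2.1]

theorem zetaPow_succ_apply (k n : ℕ) :
    zetaPow (k + 1) n = ∑ d ∈ n.divisorsAntidiagonal, zetaPow k d.2 := by
  rw [zetaPow, pow_succ', ArithmeticFunction.mul_apply]
  refine Finset.sum_congr rfl fun d hd => ?_
  have := (Nat.left_ne_zero_of_mem_divisorsAntidiagonal hd)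
  simp [zetaPow, ArithmeticFunction.zeta_apply, this]

theorem zetaPow_apply (k n : ℕ) : zetaPow k n = divisorFn k n := by
  induction k generalizing n with
  | zero =>
    rw [zetaPow, pow_zero, ArithmeticFunction.one_apply, divisorFn]
    split_ifs with h
    · rw [h, Nat.finMulAntidiag_one]; simp
    · rw [Nat.finMulAntidiag_zero_left h]; simp
  | succ k ih =>
    rw [zetaPow_succ_apply, divisorFn, card_finMulAntidiag_succ]
    push_cast
    exact Finset.sum_congr rfl fun d _ => ih d.2

theorem zetaPow_nonneg (k n : ℕ) : 0 ≤ zetaPow k n := by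
  rw [zetaPow_apply]; exact Nat.cast_nonneg _

theorem summatory_nonneg {a : ℕ → ℝ} (ha : ∀ n, 0 ≤ a n) (x : ℝ) : 0 ≤ summatory a x :=
  Finset.sum_nonneg fun n _ => ha n

theorem summatory_zetaPow_succ_nat (k : ℕ) (x : ℝ) :
    summatory (zetaPow (k + 1)) x =
      ∑ n ∈ Finset.Icc 1 ⌊x⌋₊, ∑ m ∈ Finset.Icc 1 (⌊x⌋₊ / n), zetaPow k m := by
  have := ArithmeticFunction.sum_Ioc_mul_eq_sum_sum
    ((ArithmeticFunction.zeta : ArithmeticFunction ℕ) : ArithmeticFunction ℝ) (zetaPow k) ⌊x⌋₊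
  rw [summatory, show zetaPow (k + 1) = ((ArithmeticFunction.zeta : ArithmeticFunction ℕ) :
    ArithmeticFunction ℝ) * zetaPow k from pow_succ' _ _]
  refine this.trans (Finset.sum_congr rfl fun n hn => ?_)
  have := (Finset.mem_Ioc.1 hn).1
  have : n ≠ 0 := by omega
  simp only [ArithmeticFunction.natCoe_apply, ArithmeticFunction.zeta_apply, this]
  simp
  rfl

theorem summatory_zetaPow_succ (k : ℕ) (x : ℝ) :
    summatory (zetaPow (k + 1)) x = summatory (fun n => summatory (zetaPow k) (x / n)) x := by
  rw [summatory_zetaPow_succ_nat]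
  simp only [summatory, Nat.floor_div_natCast]

theorem summatory_zetaPow_one (x : ℝ) : summatory (zetaPow 1) x = ⌊x⌋₊ := by
  rw [summatory, Finset.sum_congr rfl (g := fun _ => (1 : ℝ))]
  · simp
  · intro n hn
    have := (Finset.mem_Icc.1 hn).1
    simp [zetaPow, ArithmeticFunction.zeta_apply]; omega

theorem summatory_one_div (x : ℝ) : summatory (fun n => 1 / n) x = (harmonic ⌊x⌋₊ : ℝ) := by
  rw [harmonic_eq_sum_Icc]
  simp [summatory]

theorem summatory_zetaPow_succ_hyperbola (k : ℕ) {x : ℝ} (hx : 0 ≤ x) :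
    summatory (zetaPow (k + 1)) x =
      summatory (fun n => summatory (zetaPow k) (x / n)) (√x) +
      summatory (fun m => zetaPow k m * ⌊x / m⌋₊) (√x) -
      ⌊√x⌋₊ * summatory (zetaPow k) (√x) := by
  rw [summatory_zetaPow_succ_nat, sum_Icc_sum_Icc_div_comm]
  simp only [summatory, Nat.floor_div_natCast, floor_sqrt_eq hx]

/-- Induction through the hyperbola identity. For `n ≤ √x` one has `x / n ≥ √x`, so the inductive
expansion applies to each term with error `x^(-η/2)`, and the sum of `1 / n` costs only a logarithm.
In the second sum, replacing `⌊x/m⌋` by `x/m` costs `O(summatory a (√x) / x)`. The third term is a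
product of two known expansions. -/
theorem PolyLog.summatory_zetaPow_div (k : ℕ) :
    PolyLog fun x => summatory (zetaPow (k + 1)) x / x := by
  induction k with
  | zero => simpa [summatory_zetaPow_one] using PolyLog.floor_div
  | succ k ih =>
    set a := zetaPow (k + 1) with ha
    have ha0 : a 0 = 0 := by simp
    have hlog := (PolyLog.summatory_log_pow_div (a := a) ha0 ih 0)
    obtain ⟨P, η, hη, C, hC, H⟩ := ih
    have e1 : PolyLog fun x => summatory (fun n => summatory a (x / n)) (√x) / x -
        summatory (fun n => 1 / n * P.eval (log x - log n)) (√x) := by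
      obtain ⟨B, hB, hB'⟩ := ((PolyLog.sum_log_pow_div 0).comp_sqrt).bound
        (half_pos (half_pos hη))
      refine PolyLog.of_bound (half_pos (half_pos hη)) (C * B) fun x hx => ?_
      have hx0 : 0 < x := by linarith
      have hy0 : 0 < √x := sqrt_pos.2 hx0
      have : ∀ n ∈ Finset.Icc 1 ⌊√x⌋₊, |summatory a (x / n) / x -
          1 / n * P.eval (log x - log n)| ≤ (C * x ^ (-(η / 2))) * (1 / n) := by
        intro n hn
        have hn1 := (Finset.mem_Icc.1 hn).1
        have hn2 : (n : ℝ) ≤ √x := (Nat.le_floor_iff hy0.le).1 (Finset.mem_Icc.1 hn).2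
        have hn0 : (0 : ℝ) < n := by exact_mod_cast hn1
        have hxn : √x ≤ x / n := by
          rw [le_div_iff₀ hn0]
          calc √x * n ≤ √x * √x := by gcongr
            _ = x := mul_self_sqrt hx0.le
        have h1 := H (x / n) ((one_le_sqrt.2 hx).trans hxn)
        rw [log_div hx0.ne' hn0.ne'] at h1
        have e : summatory a (x / n) / x - 1 / n * P.eval (log x - log n) =
            1 / n * (summatory a (x / n) / (x / n) - P.eval (log x - log n)) := by
          field_simp
        rw [e, abs_mul, abs_of_pos (by positivity : (0 : ℝ) < 1 / n), mul_comm]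
        refine mul_le_mul_of_nonneg_right (h1.trans ?_) (by positivity)
        refine mul_le_mul_of_nonneg_left ?_ hC
        calc (x / n) ^ (-η) ≤ (√x) ^ (-η) :=
              rpow_le_rpow_of_nonpos hy0 hxn (by linarith)
          _ = _ := by rw [sqrt_eq_rpow, ← rpow_mul hx0.le]; ring_nf
      calc |summatory (fun n => summatory a (x / n)) (√x) / x -
            summatory (fun n => 1 / n * P.eval (log x - log n)) (√x)|
          ≤ ∑ n ∈ Finset.Icc 1 ⌊√x⌋₊, (C * x ^ (-(η / 2))) * (1 / n) := by
            change |(∑ n ∈ Finset.Icc 1 ⌊√x⌋₊, summatory a (x / n)) / x -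
              ∑ n ∈ Finset.Icc 1 ⌊√x⌋₊, 1 / (n : ℝ) * P.eval (log x - log n)| ≤ _
            rw [Finset.sum_div, ← Finset.sum_sub_distrib]
            exact (Finset.abs_sum_le_sum_abs _ _).trans (Finset.sum_le_sum this)
        _ = (C * x ^ (-(η / 2))) * summatory (fun n => 1 / n) (√x) := by
            rw [summatory, Finset.mul_sum]
        _ ≤ (C * x ^ (-(η / 2))) * (B * x ^ (η / 2 / 2)) := by
            refine mul_le_mul_of_nonneg_left ((le_abs_self _).trans ?_) (by positivity)
            simpa using hB' x hx
        _ = C * B * (x ^ (-(η / 2)) * x ^ (η / 2 / 2)) := by ring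
        _ = _ := by rw [← rpow_add hx0]; ring_nf
    have ih' : PolyLog fun x => summatory a x / x := ⟨P, η, hη, C, hC, H⟩
    have e2 : PolyLog fun x => summatory (fun m => a m * ⌊x / m⌋₊) (√x) / x -
        summatory (fun m => log m ^ 0 / m * a m) (√x) := by
      obtain ⟨B, hB, hB'⟩ := ih'.comp_sqrt.bound (by norm_num : (0 : ℝ) < 1 / 4)
      refine PolyLog.of_bound (by norm_num : (0 : ℝ) < 1 / 4) B fun x hx => ?_
      have hx0 : 0 < x := by linarith
      have hy0 : 0 < √x := sqrt_pos.2 hx0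
      have : ∀ m ∈ Finset.Icc 1 ⌊√x⌋₊, |a m * ⌊x / m⌋₊ / x - log m ^ 0 / m * a m| ≤ a m / x := by
        intro m hm
        have hm0 : (0 : ℝ) < m := by exact_mod_cast (Finset.mem_Icc.1 hm).1
        have h1 := Nat.floor_le (by positivity : 0 ≤ x / m)
        have h2 := Nat.lt_floor_add_one (x / m)
        have e : a m * ⌊x / m⌋₊ / x - log m ^ 0 / m * a m =
            (a m / x) * (⌊x / m⌋₊ - x / m) := by
          field_simp
        have h3 : 0 ≤ a m / x := div_nonneg (zetaPow_nonneg _ _) hx0.le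
        rw [e, abs_mul, abs_of_nonneg h3]
        exact mul_le_of_le_one_right h3 (by rw [abs_le]; constructor <;> linarith)
      calc |summatory (fun m => a m * ⌊x / m⌋₊) (√x) / x -
            summatory (fun m => log m ^ 0 / m * a m) (√x)|
          ≤ ∑ m ∈ Finset.Icc 1 ⌊√x⌋₊, a m / x := by
            simp only [summatory, Finset.sum_div, ← Finset.sum_sub_distrib]
            exact (Finset.abs_sum_le_sum_abs _ _).trans (Finset.sum_le_sum this)
        _ = summatory a (√x) / √x * x ^ (-(1 / 2) : ℝ) := by
            rw [← Finset.sum_div, rpow_neg hx0.le, ← sqrt_eq_rpow, ← div_eq_mul_inv, div_div,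
              mul_self_sqrt hx0.le]
            rfl
        _ ≤ (B * x ^ (1 / 4 : ℝ)) * x ^ (-(1 / 2) : ℝ) :=
            mul_le_mul_of_nonneg_right ((le_abs_self _).trans (hB' x hx)) (by positivity)
        _ = _ := by rw [mul_assoc, ← rpow_add hx0]; norm_num
    have e3 := (PolyLog.floor_div.comp_sqrt).mul ih'.comp_sqrt
    refine (((e1.add (PolyLog.sum_eval_log_sub P)).add (e2.add hlog.comp_sqrt)).sub e3).congr
      fun x hx => ?_
    have hx0 : 0 < x := by linarith
    have hy0 : 0 < √x := sqrt_pos.2 hx0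
    rw [summatory_zetaPow_succ_hyperbola (k + 1) hx0.le, ← ha, sub_div, add_div]
    have : (⌊√x⌋₊ : ℝ) / √x * (summatory a (√x) / √x) = ⌊√x⌋₊ * summatory a (√x) / x := by
      rw [div_mul_div_comm, mul_self_sqrt hx0.le]
    rw [this]
    ring

/-! ### Degree and leading coefficient of the main term -/

theorem summatory_zetaPow_le (k : ℕ) {x : ℝ} (hx : 1 ≤ x) :
    summatory (zetaPow (k + 1)) x ≤ x * (1 + log x) ^ k := by
  induction k generalizing x with
  | zero => simpa [summatory_zetaPow_one] using Nat.floor_le (by linarith)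
  | succ k ih =>
    have hx0 : 0 < x := by linarith
    rw [summatory_zetaPow_succ]
    calc summatory (fun n => summatory (zetaPow (k + 1)) (x / n)) x
        ≤ ∑ n ∈ Finset.Icc 1 ⌊x⌋₊, x * (1 + log x) ^ k * (1 / n) := by
          refine Finset.sum_le_sum fun n hn => ?_
          have hn0 : (0 : ℝ) < n := by exact_mod_cast (Finset.mem_Icc.1 hn).1
          have hn1 : (1 : ℝ) ≤ n := by exact_mod_cast (Finset.mem_Icc.1 hn).1
          have hn2 : (n : ℝ) ≤ x := (Nat.le_floor_iff hx0.le).1 (Finset.mem_Icc.1 hn).2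
          have h1 : 1 ≤ x / n := by rwa [le_div_iff₀ hn0, one_mul]
          refine (ih h1).trans ?_
          have h2 : log (x / n) ≤ log x := log_le_log (by positivity) (div_le_self hx0.le hn1)
          have h3 : 0 ≤ log (x / n) := log_nonneg h1
          calc x / n * (1 + log (x / n)) ^ k ≤ x / n * (1 + log x) ^ k := by gcongr
            _ = _ := by ring
      _ = x * (1 + log x) ^ k * (harmonic ⌊x⌋₊ : ℝ) := by
          rw [← summatory_one_div, summatory, Finset.mul_sum]
      _ ≤ x * (1 + log x) ^ k * (1 + log x) := by
          have := log_nonneg hx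
          exact mul_le_mul_of_nonneg_left (harmonic_floor_le_one_add_log x hx) (by positivity)
      _ = _ := by ring

/-- Keeping only `n ≤ √x` ensures `log (x / n) ≥ log x / 2`. With the matching upper bound this
fixes the order of growth, so the polynomial of the hyperbola method need not be computed. -/
theorem exists_le_summatory_zetaPow (k : ℕ) :
    ∃ c : ℝ, 0 < c ∧ ∀ x : ℝ, 1 ≤ x → c * (x * log x ^ k) ≤ summatory (zetaPow (k + 1)) x := by
  induction k with
  | zero =>
    refine ⟨1 / 2, by norm_num, fun x hx => ?_⟩
    rw [summatory_zetaPow_one]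
    have h1 := Nat.lt_floor_add_one x
    have h2 : (1 : ℝ) ≤ ⌊x⌋₊ := by exact_mod_cast (Nat.one_le_floor_iff x).2 hx
    simp only [pow_zero]
    linarith
  | succ k ih =>
    obtain ⟨c, hc, ih⟩ := ih
    refine ⟨c * (1 / 2) ^ (k + 1), by positivity, fun x hx => ?_⟩
    have hx0 : 0 < x := by linarith
    have hy0 : 0 < √x := sqrt_pos.2 hx0
    have hlx := log_nonneg hx
    rw [summatory_zetaPow_succ]
    calc c * (1 / 2) ^ (k + 1) * (x * log x ^ (k + 1))
        = c * x * (log x / 2) ^ k * log (√x) := by rw [log_sqrt hx0.le]; ring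
      _ ≤ c * x * (log x / 2) ^ k * (harmonic ⌊√x⌋₊ : ℝ) :=
          mul_le_mul_of_nonneg_left (log_le_harmonic_floor _ hy0.le) (by positivity)
      _ = ∑ n ∈ Finset.Icc 1 ⌊√x⌋₊, c * x * (log x / 2) ^ k * (1 / n) := by
          rw [← summatory_one_div, summatory, Finset.mul_sum]
      _ ≤ ∑ n ∈ Finset.Icc 1 ⌊√x⌋₊, summatory (zetaPow (k + 1)) (x / n) := by
          refine Finset.sum_le_sum fun n hn => ?_
          have hn0 : (0 : ℝ) < n := by exact_mod_cast (Finset.mem_Icc.1 hn).1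
          have hn2 : (n : ℝ) ≤ √x := (Nat.le_floor_iff hy0.le).1 (Finset.mem_Icc.1 hn).2
          have hxn : √x ≤ x / n := by
            rw [le_div_iff₀ hn0]
            calc √x * n ≤ √x * √x := by gcongr
              _ = x := mul_self_sqrt hx0.le
          refine le_trans ?_ (ih (x / n) ((one_le_sqrt.2 hx).trans hxn))
          have h2 : log x / 2 ≤ log (x / n) := by
            rw [← log_sqrt hx0.le]; exact log_le_log hy0 hxn
          calc c * x * (log x / 2) ^ k * (1 / n) = c * (x / n * (log x / 2) ^ k) := by ring
            _ ≤ _ := by gcongr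
      _ ≤ _ := Finset.sum_le_sum_of_subset_of_nonneg
          (Finset.Icc_subset_Icc le_rfl (Nat.floor_mono (sqrt_le_iff.2 ⟨hx0.le, by nlinarith⟩)))
          fun n _ _ => summatory_nonneg (zetaPow_nonneg _) _

theorem leadingCoeff_nonneg_of_eval_nonneg {p : Polynomial ℝ} (h : ∀ x : ℝ, 0 ≤ x → 0 ≤ p.eval x) :
    0 ≤ p.leadingCoeff := by
  by_contra! hlt
  rcases lt_or_ge 0 p.degree with hd | hd
  · have := p.tendsto_atBot_of_leadingCoeff_nonpos hd hlt.le
    obtain ⟨x, hx0, hx⟩ := ((eventually_ge_atTop 0).and (this.eventually_lt_atBot 0)).exists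
    exact absurd (h x hx0) (not_le.2 hx)
  · rw [Polynomial.eq_C_of_degree_le_zero hd] at h hlt
    simp at hlt
    have := h 0 le_rfl
    simp at this
    linarith

theorem coeff_nonneg_of_eval_nonneg {p : Polynomial ℝ} (h : ∀ x : ℝ, 0 ≤ x → 0 ≤ p.eval x) {m : ℕ}
    (hm : p.natDegree ≤ m) : 0 ≤ p.coeff m := by
  rcases hm.lt_or_eq with hlt | rfl
  · rw [Polynomial.coeff_eq_zero_of_natDegree_lt hlt]
  · exact leadingCoeff_nonneg_of_eval_nonneg h

/-- If `P` had degree above `m`, the two comparisons would force its leading coefficient to be both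
nonnegative and nonpositive. Once the degree is at most `m`, the lower comparison can be read off in
degree `m`; `m ≥ 1` keeps the constant `C` out of that coefficient. -/
theorem natDegree_le_and_le_coeff {P : Polynomial ℝ} {m : ℕ} (hm : 1 ≤ m) {c C : ℝ}
    (hl : ∀ x : ℝ, 0 ≤ x → c * x ^ m - C ≤ P.eval x)
    (hu : ∀ x : ℝ, 0 ≤ x → P.eval x ≤ (1 + x) ^ m + C) :
    P.natDegree ≤ m ∧ c ≤ P.coeff m := by
  have hl' : ∀ x : ℝ, 0 ≤ x →
      0 ≤ (P - (Polynomial.C c * Polynomial.X ^ m - Polynomial.C C)).eval x := fun x hx => by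
    have := hl x hx
    simp only [Polynomial.eval_sub, Polynomial.eval_mul, Polynomial.eval_C, Polynomial.eval_pow,
      Polynomial.eval_X]
    linarith
  have hu' : ∀ x : ℝ, 0 ≤ x →
      0 ≤ (((1 + Polynomial.X) ^ m + Polynomial.C C) - P).eval x := fun x hx => by
    have := hu x hx
    simp only [Polynomial.eval_sub, Polynomial.eval_C, Polynomial.eval_pow,
      Polynomial.eval_X, Polynomial.eval_add, Polynomial.eval_one]
    linarith
  have d1 : (Polynomial.C c * Polynomial.X ^ m - Polynomial.C C).natDegree ≤ m := by
    compute_degree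
  have d2 : ((1 + Polynomial.X) ^ m + Polynomial.C C : Polynomial ℝ).natDegree ≤ m := by
    refine (Polynomial.natDegree_add_le _ _).trans (max_le ?_ (by simp))
    refine (Polynomial.natDegree_pow_le).trans ?_
    have : (1 + Polynomial.X : Polynomial ℝ).natDegree ≤ 1 := by compute_degree
    nlinarith
  have hdeg : P.natDegree ≤ m := by
    by_contra! hlt
    have h1 := leadingCoeff_nonneg_of_eval_nonneg hl'
    have h2 := leadingCoeff_nonneg_of_eval_nonneg hu'
    rw [Polynomial.leadingCoeff_sub_of_degree_lt
      (Polynomial.degree_lt_degree (d1.trans_lt hlt))] at h1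
    rw [Polynomial.leadingCoeff_sub_of_degree_lt'
      (Polynomial.degree_lt_degree (d2.trans_lt hlt))] at h2
    have h3 : P.leadingCoeff = 0 := by linarith
    rw [Polynomial.leadingCoeff_eq_zero] at h3
    simp [h3] at hlt
  refine ⟨hdeg, ?_⟩
  have := coeff_nonneg_of_eval_nonneg hl'
    ((Polynomial.natDegree_sub_le _ _).trans (max_le hdeg d1))
  have hm0 : m ≠ 0 := by omega
  simp [Polynomial.coeff_C, hm0] at this
  exact this

/-- Asymptotic expansion of the summatory function of `d_{m+1}`, `m ≥ 1`. -/
theorem exists_summatory_zetaPow_asymptotic {m : ℕ} (hm : 1 ≤ m) :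
    ∃ P : Polynomial ℝ, P.natDegree ≤ m ∧ 0 < P.coeff m ∧ ∃ η : ℝ, 0 < η ∧ η < 1 ∧ ∃ C : ℝ, 0 ≤ C ∧
      ∀ x : ℝ, 0 < x → |summatory (zetaPow (m + 1)) x - x * P.eval (log x)| ≤ C * x ^ (1 - η) := by
  obtain ⟨P, η, hη, C, hC, H⟩ := PolyLog.summatory_zetaPow_div m
  obtain ⟨c, hc, hl⟩ := exists_le_summatory_zetaPow m
  have hexp : ∀ y : ℝ, 0 ≤ y → exp y ^ (-η) ≤ 1 := fun y hy =>
    rpow_le_one_of_one_le_of_nonpos (one_le_exp hy) (by linarith)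
  have hH : ∀ y : ℝ, 0 ≤ y →
      |summatory (zetaPow (m + 1)) (exp y) / exp y - P.eval y| ≤ C := fun y hy => by
    have := H (exp y) (one_le_exp hy)
    rw [log_exp] at this
    exact this.trans (mul_le_of_le_one_right hC (hexp y hy))
  obtain ⟨hdeg, hcoeff⟩ := natDegree_le_and_le_coeff (P := P) hm (c := c) (C := C)
    (fun y hy => by
      have h1 := (abs_le.1 (hH y hy)).2
      have h2 := hl (exp y) (one_le_exp hy)
      rw [log_exp] at h2
      have h3 : c * y ^ m ≤ summatory (zetaPow (m + 1)) (exp y) / exp y := by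
        rw [le_div_iff₀ (exp_pos y)]; linarith
      linarith)
    (fun y hy => by
      have h1 := (abs_le.1 (hH y hy)).1
      have h2 := summatory_zetaPow_le m (one_le_exp hy)
      rw [log_exp] at h2
      have h3 : summatory (zetaPow (m + 1)) (exp y) / exp y ≤ (1 + y) ^ m := by
        rw [div_le_iff₀ (exp_pos y)]; linarith
      linarith)
  -- Capping the saving at `1/2` keeps the exponent `1 - θ` positive, which makes the error monotone
  -- in `x` later on.
  set θ := min η (1 / 2)
  have hθ : 0 < θ := lt_min hη (by norm_num)
  obtain ⟨D, hD, HD⟩ := exists_abs_eval_log_le (P.comp (-Polynomial.X)) hθ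
  refine ⟨P, hdeg, hc.trans_le hcoeff, θ, hθ, (min_le_right _ _).trans_lt (by norm_num), max C D,
    hC.trans (le_max_left _ _), fun x hx => ?_⟩
  rcases le_or_gt 1 x with h1 | h1
  · have e : summatory (zetaPow (m + 1)) x - x * P.eval (log x) =
        x * (summatory (zetaPow (m + 1)) x / x - P.eval (log x)) := by field_simp
    rw [e, abs_mul, abs_of_pos hx]
    calc x * |summatory (zetaPow (m + 1)) x / x - P.eval (log x)| ≤ x * (C * x ^ (-θ)) := by
          refine mul_le_mul_of_nonneg_left ((H x h1).trans ?_) hx.le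
          exact mul_le_mul_of_nonneg_left (rpow_le_rpow_of_exponent_le h1
            (neg_le_neg (min_le_left _ _))) hC
      _ = C * x ^ (1 - θ) := by
          rw [sub_eq_add_neg, rpow_add hx, rpow_one]; ring
      _ ≤ _ := mul_le_mul_of_nonneg_right (le_max_left _ _) (by positivity)
  -- The range `x < 1` is needed because the local operators evaluate at `x / p^j`. There the sum is
  -- empty, and the growth bound for `P(-X)` at `1/x` shows that `x P(log x)` is itself within the
  -- error.
  · rw [summatory_of_lt_one _ h1, zero_sub, abs_neg, abs_mul, abs_of_pos hx]
    have := HD x⁻¹ (one_le_inv₀ hx |>.2 h1.le)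
    rw [log_inv, Polynomial.eval_comp] at this
    simp only [Polynomial.eval_neg, Polynomial.eval_X, neg_neg] at this
    calc x * |P.eval (log x)| ≤ x * (D * x⁻¹ ^ θ) := mul_le_mul_of_nonneg_left this hx.le
      _ = D * x ^ (1 - θ) := by
          rw [inv_rpow hx.le, sub_eq_add_neg, rpow_add hx, rpow_one, rpow_neg hx.le]; ring
      _ ≤ _ := mul_le_mul_of_nonneg_right (le_max_right _ _) (by positivity)

/-! ### Smooth weights -/

namespace IsSmoothCutoff

variable {ε : ℝ} {Φ : ℝ → ℝ}

/-- This removes the boundary term at `n = x` in the partial summations. -/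
theorem apply_one (h : IsSmoothCutoff ε Φ) : Φ 1 = 0 := by
  have hcl : IsClosed {t | Φ t = 0} := isClosed_singleton.preimage h.smooth.continuous
  have hsub : Ioi (1 : ℝ) ⊆ {t | Φ t = 0} := fun t ht =>
    image_eq_zero_of_notMem_tsupport fun hmem => not_le.2 ht (h.support_subset hmem).2
  have := closure_minimal hsub hcl
  rw [closure_Ioi] at this
  exact this self_mem_Ici

theorem hasDerivAt (h : IsSmoothCutoff ε Φ) (t : ℝ) : HasDerivAt Φ (deriv Φ t) t :=
  (h.smooth.differentiable (by simp) t).hasDerivAt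

theorem continuous_deriv (h : IsSmoothCutoff ε Φ) : Continuous (deriv Φ) :=
  h.smooth.continuous_deriv (by simp)

theorem integral_deriv_mul_id (h : IsSmoothCutoff ε Φ) :
    -∫ t in (0 : ℝ)..1, deriv Φ t * t = ∫ t in (0 : ℝ)..1, Φ t := by
  have := intervalIntegral.integral_deriv_mul_eq_sub (a := 0) (b := 1)
    (u := Φ) (u' := deriv Φ) (v := fun t => t) (v' := fun _ => 1)
    (fun t _ => h.hasDerivAt t) (fun t _ => hasDerivAt_id t)
    (h.continuous_deriv.intervalIntegrable _ _) (continuous_const.intervalIntegrable _ _)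
  rw [intervalIntegral.integral_add] at this
  · simp only [mul_one, h.apply_one, mul_zero, sub_zero] at this
    linarith
  · exact (h.continuous_deriv.mul continuous_id).intervalIntegrable _ _
  · exact (h.smooth.continuous.mul continuous_const).intervalIntegrable _ _

theorem summatory_mul_eq (h : IsSmoothCutoff ε Φ) {a : ℕ → ℝ} (ha : a 0 = 0) {x : ℝ} (hx : 0 < x) :
    summatory (fun n => a n * Φ (n / x)) x =
      -∫ u in (0 : ℝ)..1, deriv Φ u * summatory a (x * u) := by
  have hder : ∀ t : ℝ, HasDerivAt (fun t => Φ (t / x)) (deriv Φ (t / x) * (1 / x)) t := fun t =>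
    (h.hasDerivAt (t / x)).comp t ((hasDerivAt_id t).div_const x)
  have hderiv : deriv (fun t => Φ (t / x)) = fun t => deriv Φ (t / x) * (1 / x) :=
    funext fun t => (hder t).deriv
  have hcont : Continuous (fun t => deriv Φ (t / x) * (1 / x)) :=
    (h.continuous_deriv.comp (continuous_id.div_const x)).mul continuous_const
  have := sum_mul_eq_sub_integral_mul a (f := fun t => Φ (t / x)) hx.le
    (fun t _ => (hder t).differentiableAt) (by rw [hderiv]; exact hcont.integrableOn_Icc)
  rw [hderiv] at this
  simp only [summatory_eq_sum_Icc_zero ha, div_self hx.ne', h.apply_one, zero_mul, zero_sub] at this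
  rw [← summatory_eq_sum_Icc_zero (by simp [ha]), Finset.sum_congr rfl fun n _ => mul_comm _ _,
    this, ← intervalIntegral.integral_of_le hx.le]
  congr 1
  have := intervalIntegral.smul_integral_comp_mul_left (a := 0) (b := 1)
    (fun t => deriv Φ (t / x) * (1 / x) * summatory a t) x
  rw [mul_zero, mul_one] at this
  rw [← this, smul_eq_mul, ← intervalIntegral.integral_const_mul]
  refine intervalIntegral.integral_congr fun u _ => ?_
  rw [mul_div_cancel_left₀ _ hx.ne']
  field_simp

theorem intervalIntegrable_deriv_mul_log_pow (h : IsSmoothCutoff ε Φ) (i : ℕ) :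
    IntervalIntegrable (fun u => deriv Φ u * (u * log u ^ i)) volume 0 1 := by
  have : IntervalIntegrable (fun u : ℝ => u * log u ^ i) volume 0 1 := by
    rw [intervalIntegrable_iff_integrableOn_Ioc_of_le zero_le_one]
    obtain ⟨C, hC, H⟩ := exists_abs_eval_log_le (Polynomial.X ^ i) one_pos
    refine Measure.integrableOn_of_bounded (M := C) (by simp)
      ((measurable_id.mul (measurable_log.pow_const i)).aestronglyMeasurable) ?_
    filter_upwards [ae_restrict_mem measurableSet_Ioc] with u hu
    have hu0 := hu.1
    have := H u⁻¹ (one_le_inv₀ hu0 |>.2 hu.2)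
    rw [log_inv, rpow_one] at this
    simp only [Polynomial.eval_pow, Polynomial.eval_X, abs_pow, abs_neg] at this
    rw [norm_eq_abs, abs_mul, abs_of_pos hu0, abs_pow]
    calc u * |log u| ^ i ≤ u * (C * u⁻¹) := mul_le_mul_of_nonneg_left this hu0.le
      _ = C := by field_simp
  exact this.continuousOn_mul h.continuous_deriv.continuousOn

end IsSmoothCutoff

theorem polynomial_eval_add_eq_sum {P : Polynomial ℝ} {m : ℕ} (hP : P.natDegree ≤ m) (x y : ℝ) :
    P.eval (x + y) =
      ∑ i ∈ Finset.range (m + 1), (Polynomial.hasseDeriv i P).eval x * y ^ i := by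
  rw [add_comm, ← Polynomial.taylor_eval, Polynomial.eval_eq_sum_range' (n := m + 1)
    (by rw [Polynomial.natDegree_taylor]; omega)]
  simp [Polynomial.taylor_coeff]

/-- Asymptotic expansion of the smoothed summatory function of `d_{m+1}`, `m ≥ 1`. The leading
coefficient is bounded below independently of the cutoff. -/
theorem exists_smooth_summatory_zetaPow_asymptotic {m : ℕ} (hm : 1 ≤ m) :
    ∃ c : ℝ, 0 < c ∧ ∀ ε : ℝ, ε ≤ 1 / 2 → ∀ Φ : ℝ → ℝ, IsSmoothCutoff ε Φ →
      ∃ Q : Polynomial ℝ, Q.natDegree ≤ m ∧ c ≤ Q.coeff m ∧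
        ∃ η : ℝ, 0 < η ∧ η < 1 ∧ ∃ C : ℝ, 0 ≤ C ∧ ∀ x : ℝ, 0 < x →
          |summatory (fun n => zetaPow (m + 1) n * Φ (n / x)) x - x * Q.eval (log x)| ≤
            C * x ^ (1 - η) := by
  obtain ⟨P, hdeg, hpos, η, hη, hη1, C, hC, H⟩ := exists_summatory_zetaPow_asymptotic hm
  refine ⟨P.coeff m / 2, half_pos hpos, fun ε hε Φ hΦ => ?_⟩
  -- Taylor expansion of `P(log x + log u)` in `log u` turns the integral against `-Φ'(u) u` into
  -- these moments.
  set μ : ℕ → ℝ := fun i => -∫ u in (0 : ℝ)..1, deriv Φ u * (u * log u ^ i)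
  obtain ⟨M, hM⟩ := isCompact_Icc.exists_bound_of_continuousOn (s := Icc (0 : ℝ) 1)
    hΦ.continuous_deriv.continuousOn
  have hM0 : 0 ≤ M := (norm_nonneg _).trans (hM 0 ⟨le_rfl, zero_le_one⟩)
  refine ⟨∑ i ∈ Finset.range (m + 1), Polynomial.C (μ i) * Polynomial.hasseDeriv i P, ?_, ?_, η, hη,
    hη1, M * C, by positivity, fun x hx => ?_⟩
  · refine Polynomial.natDegree_sum_le_of_forall_le _ _ fun i _ => ?_
    refine (Polynomial.natDegree_C_mul_le _ _).trans ?_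
    exact (Polynomial.natDegree_hasseDeriv_le P i).trans (by omega)
  -- Hasse derivatives of positive order have degree below `m`, so only `μ 0 = ∫ Φ ≥ 1/2` reaches
  -- the top coefficient. Hence the bound is free of `Φ`.
  · rw [Polynomial.finsetSum_coeff, Finset.sum_eq_single 0]
    · have : μ 0 = ∫ t in (0 : ℝ)..1, Φ t := by
        rw [← hΦ.integral_deriv_mul_id]; simp [μ]
      have h2 := hΦ.integral_ge
      rw [Polynomial.coeff_C_mul, this]
      simp only [Polynomial.hasseDeriv_zero']
      nlinarith
    · intro i _ hi
      rw [Polynomial.coeff_C_mul, Polynomial.hasseDeriv_coeff,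
        Polynomial.coeff_eq_zero_of_natDegree_lt (n := m + i) (by omega)]
      simp
    · simp
  · set S := summatory (zetaPow (m + 1))
    have hint : ∀ i, IntervalIntegrable (fun u => x * (Polynomial.hasseDeriv i P).eval (log x) *
        (deriv Φ u * (u * log u ^ i))) volume 0 1 := fun i =>
      (hΦ.intervalIntegrable_deriv_mul_log_pow i).const_mul _
    have e1 : x * (∑ i ∈ Finset.range (m + 1), Polynomial.C (μ i) *
        Polynomial.hasseDeriv i P).eval (log x) =
        -∫ u in (0 : ℝ)..1, ∑ i ∈ Finset.range (m + 1),
          x * (Polynomial.hasseDeriv i P).eval (log x) * (deriv Φ u * (u * log u ^ i)) := by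
      rw [intervalIntegral.integral_finsetSum fun i _ => hint i, Polynomial.eval_finsetSum,
        Finset.mul_sum, ← Finset.sum_neg_distrib]
      refine Finset.sum_congr rfl fun i _ => ?_
      rw [intervalIntegral.integral_const_mul, Polynomial.eval_mul, Polynomial.eval_C]
      simp only [μ]
      ring
    have hSint : IntervalIntegrable (fun u => deriv Φ u * S (x * u)) volume 0 1 := by
      have := (intervalIntegrable_mul_summatory (a := zetaPow (m + 1)) (by simp) (g := fun t =>
        deriv Φ (t / x)) le_rfl hx.le
        (hΦ.continuous_deriv.comp (continuous_id.div_const x)).continuousOn).comp_mul_left (c := x)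
      simpa [hx.ne'] using this
    have hsum := IntervalIntegrable.sum (Finset.range (m + 1)) fun i _ => hint i
    rw [Finset.sum_fn] at hsum
    rw [hΦ.summatory_mul_eq (by simp) hx, e1, neg_sub_neg, ← intervalIntegral.integral_sub
      hsum hSint, ← norm_eq_abs]
    have : ∀ u ∈ uIoc (0 : ℝ) 1, ‖(∑ i ∈ Finset.range (m + 1),
        x * (Polynomial.hasseDeriv i P).eval (log x) * (deriv Φ u * (u * log u ^ i))) -
        deriv Φ u * S (x * u)‖ ≤ M * C * x ^ (1 - η) := by
      intro u hu
      rw [uIoc_of_le zero_le_one] at hu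
      have hu0 := hu.1
      have e2 : (∑ i ∈ Finset.range (m + 1),
          x * (Polynomial.hasseDeriv i P).eval (log x) * (deriv Φ u * (u * log u ^ i))) =
          deriv Φ u * (x * u * P.eval (log (x * u))) := by
        rw [log_mul hx.ne' hu0.ne', polynomial_eval_add_eq_sum hdeg, Finset.mul_sum, Finset.mul_sum]
        exact Finset.sum_congr rfl fun i _ => by ring
      rw [e2, ← mul_sub, norm_mul, norm_sub_rev, mul_assoc M]
      refine mul_le_mul (hM u (Ioc_subset_Icc_self hu)) ((H (x * u) (by positivity)).trans ?_)
        (norm_nonneg _) hM0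
      refine mul_le_mul_of_nonneg_left (rpow_le_rpow (by positivity) ?_ (by linarith)) hC
      exact mul_le_of_le_one_right hx.le hu.2
    simpa using intervalIntegral.norm_integral_le_of_norm_le_const this

/-! ### Euler factors as operators on summatory functions -/

/-- The arithmetic function supported at `p`, with value `1` there. -/
def singleArith (p : ℕ) (hp : p ≠ 0) : ArithmeticFunction ℝ :=
  ⟨fun n => if n = p then 1 else 0, by simp [hp.symm]⟩

theorem singleArith_mul_apply {p : ℕ} (hp : p ≠ 0) (f : ArithmeticFunction ℝ) (n : ℕ) :
    (singleArith p hp * f) n = if p ∣ n then f (n / p) else 0 := by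
  rcases eq_or_ne n 0 with rfl | hn
  · simp
  rw [ArithmeticFunction.mul_apply]
  have h : ∀ x ∈ n.divisorsAntidiagonal, singleArith p hp x.1 * f x.2 =
      if x.1 = p then f x.2 else 0 := fun x _ => by simp [singleArith]
  rw [Finset.sum_congr rfl h]
  split_ifs with hd
  · rw [Finset.sum_eq_single (p, n / p)]
    · simp
    · rintro ⟨a, b⟩ hab hne
      rw [if_neg]
      rintro rfl
      refine hne ?_
      rw [Nat.mem_divisorsAntidiagonal] at hab
      simp only [← hab.1]
      rw [Nat.mul_div_cancel_left _ (Nat.pos_of_ne_zero hp)]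
    · intro h
      exact absurd (Nat.mem_divisorsAntidiagonal.2 ⟨Nat.mul_div_cancel' hd, hn⟩) h
  · refine Finset.sum_eq_zero fun x hx => ?_
    rw [if_neg]
    rintro rfl
    exact hd ⟨x.2, (Nat.mem_divisorsAntidiagonal.1 hx).1.symm⟩

theorem singleArith_pow_mul_apply {p : ℕ} (hp : p ≠ 0) (f : ArithmeticFunction ℝ) (j n : ℕ) :
    (singleArith p hp ^ j * f) n = if p ^ j ∣ n then f (n / p ^ j) else 0 := by
  induction j generalizing n with
  | zero => simp
  | succ j ih =>
    rw [pow_succ', mul_assoc, singleArith_mul_apply]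
    by_cases h : p ∣ n
    · rw [if_pos h, ih, Nat.div_div_eq_div_mul, ← pow_succ']
      have : p ^ j ∣ n / p ↔ p ^ (j + 1) ∣ n := by
        rw [Nat.dvd_div_iff_mul_dvd h, ← pow_succ']
      simp only [this]
    · rw [if_neg h, if_neg]
      exact fun h' => h ((dvd_pow_self p j.succ_ne_zero).trans h')

/-- Multiplication by `1 - p⁻ˢ` removes the Euler factor at `p` from `ζ`, leaving the indicator of
`p ∤ n`; convolution powers of it only see integers prime to `p`. -/
theorem one_sub_singleArith_mul_zeta_pow_apply {p : ℕ} (hp : p.Prime) (k n : ℕ) :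
    (((1 - singleArith p hp.ne_zero) *
      ((ArithmeticFunction.zeta : ArithmeticFunction ℕ) : ArithmeticFunction ℝ)) ^ k) n =
      if p ∣ n then 0 else zetaPow k n := by
  induction k generalizing n with
  | zero =>
    rw [pow_zero, zetaPow, pow_zero, ArithmeticFunction.one_apply]
    split_ifs with h1 h2 h2
    · subst h1; exact absurd (Nat.dvd_one.1 h2) hp.ne_one
    all_goals rfl
  | succ k ih =>
    rw [pow_succ', ArithmeticFunction.mul_apply, zetaPow_succ_apply]
    have h1 : ∀ x ∈ n.divisorsAntidiagonal, ((1 - singleArith p hp.ne_zero) *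
        ((ArithmeticFunction.zeta : ArithmeticFunction ℕ) : ArithmeticFunction ℝ)) x.1 =
        if p ∣ x.1 then 0 else 1 := by
      intro x hx
      have hx0 := Nat.left_ne_zero_of_mem_divisorsAntidiagonal hx
      rw [sub_mul, one_mul, sub_eq_add_neg, ArithmeticFunction.add_apply,
        show ∀ f : ArithmeticFunction ℝ, (-f) x.1 = -f x.1 from fun _ => rfl, singleArith_mul_apply]
      have hd : p ∣ x.1 → x.1 / p ≠ 0 := fun h =>
        (Nat.div_pos (Nat.le_of_dvd (Nat.pos_of_ne_zero hx0) h) hp.pos).ne'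
      simp only [ArithmeticFunction.natCoe_apply, ArithmeticFunction.zeta_apply, hx0]
      by_cases h : p ∣ x.1
      · rw [if_pos h, if_pos h, if_neg (hd h)]; simp
      · rw [if_neg h, if_neg h]; simp
    split_ifs with hn
    · refine Finset.sum_eq_zero fun x hx => ?_
      rw [h1 x hx, ih]
      rw [← (Nat.mem_divisorsAntidiagonal.1 hx).1, hp.dvd_mul] at hn
      rcases hn with h | h <;> simp [h]
    · refine Finset.sum_congr rfl fun x hx => ?_
      rw [h1 x hx, ih]
      rw [← (Nat.mem_divisorsAntidiagonal.1 hx).1, hp.dvd_mul, not_or] at hn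
      simp [hn.1, hn.2]

/-- The binomial expansion of `(1 - p⁻ˢ)^k ζ(s)^k`, read coefficientwise. -/
theorem zetaPow_coprime_part {p : ℕ} (hp : p.Prime) (k n : ℕ) :
    (if p ∣ n then 0 else zetaPow k n) = ∑ j ∈ Finset.range (k + 1),
      (-1 : ℝ) ^ j * k.choose j * (if p ^ j ∣ n then zetaPow k (n / p ^ j) else 0) := by
  rw [← one_sub_singleArith_mul_zeta_pow_apply hp, mul_pow, sub_eq_add_neg, add_comm, add_pow,
    Finset.sum_mul]
  have hev : ∀ (t : Finset ℕ) (f : ℕ → ArithmeticFunction ℝ),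
      (∑ j ∈ t, f j) n = ∑ j ∈ t, f j n := fun t f => by
    induction t using Finset.cons_induction with
    | empty => simp
    | cons a t ha ih => rw [Finset.sum_cons, Finset.sum_cons, ArithmeticFunction.add_apply, ih]
  rw [hev]
  refine Finset.sum_congr rfl fun j _ => ?_
  rw [one_pow, mul_one, ← singleArith_pow_mul_apply hp.ne_zero]
  have e : (-singleArith p hp.ne_zero) ^ j * (k.choose j : ArithmeticFunction ℝ) *
      ((ArithmeticFunction.zeta : ArithmeticFunction ℕ) : ArithmeticFunction ℝ) ^ k =
      ((-1) ^ j * (k.choose j : ℤ) : ℤ) • (singleArith p hp.ne_zero ^ j * zetaPow k) := by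
    rw [zsmul_eq_mul, zetaPow, neg_pow]
    push_cast
    ring
  rw [e]
  have hz : ∀ (z : ℤ) (f : ArithmeticFunction ℝ), (z • f) n = z * f n := fun z f => by
    have := map_zsmul (AddMonoidHom.mk' (fun f : ArithmeticFunction ℝ => f n)
      fun a b => ArithmeticFunction.add_apply) z f
    simpa using this
  rw [hz]
  push_cast
  ring

theorem summatory_dvd {d : ℕ} (hd : 0 < d) (g : ℕ → ℝ) (x : ℝ) :
    summatory (fun n => if d ∣ n then g (n / d) else 0) x = summatory g (x / d) := by
  rw [summatory, summatory, ← Finset.sum_filter, Nat.floor_div_natCast]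
  symm
  refine Finset.sum_bij' (fun m _ => d * m) (fun n _ => n / d) ?_ ?_ ?_ ?_ ?_
  · intro m hm
    simp only [Finset.mem_Icc, Finset.mem_filter, Nat.le_div_iff_mul_le hd] at hm ⊢
    refine ⟨⟨Nat.mul_pos hd hm.1, by rw [mul_comm]; exact hm.2⟩, dvd_mul_right d m⟩
  · intro n hn
    simp only [Finset.mem_Icc, Finset.mem_filter] at hn ⊢
    exact ⟨Nat.div_pos (Nat.le_of_dvd hn.1.1 hn.2) hd, Nat.div_le_div_right hn.1.2⟩
  · intro m _
    exact Nat.mul_div_cancel_left m hd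
  · intro n hn
    exact Nat.mul_div_cancel' (Finset.mem_filter.1 hn).2
  · intro m _
    rw [Nat.mul_div_cancel_left m hd]

/-- `∏_{p ∈ s} c_p(n)`, where `c_p` is the Ramanujan sum modulo the prime `p`. -/
def ramanujanProd (s : Finset ℕ) (n : ℕ) : ℝ := ∏ p ∈ s, ((if p ∣ n then (p : ℝ) else 0) - 1)

/-- The operator on functions of a real variable that corresponds to multiplying a Dirichlet
series by `(p - 1) - p (1 - p⁻ˢ)ᵏ`. -/
noncomputable def localOp (k p : ℕ) (G : ℝ → ℝ) (x : ℝ) : ℝ :=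
  (p - 1) * G x - p * ∑ j ∈ Finset.range (k + 1), (-1 : ℝ) ^ j * k.choose j * G (x / (p ^ j : ℕ))

theorem localOp_sub (k p : ℕ) (G H : ℝ → ℝ) (x : ℝ) :
    localOp k p (fun x => G x - H x) x = localOp k p G x - localOp k p H x := by
  simp only [localOp, mul_sub, Finset.sum_sub_distrib]
  ring

/-- The new factor is `(p - 1) - p·1_{p∤n}`, and `zetaPow_coprime_part` turns the indicator into
dilations by `p^j`. The factors at the other primes do not change when `n` is multiplied by `p^j`.
-/
theorem summatory_ramanujanProd_insert {k p : ℕ} (hp : p.Prime) {s : Finset ℕ}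
    (hs : ∀ r ∈ s, r.Prime) (hps : p ∉ s) (Φ : ℝ → ℝ) {x : ℝ} (hx : 0 < x) :
    summatory (fun n => zetaPow k n * ramanujanProd (insert p s) n * Φ (n / x)) x =
      localOp k p
        (fun x => summatory (fun n => zetaPow k n * ramanujanProd s n * Φ (n / x)) x) x := by
  have hstep : ∀ j : ℕ, summatory (fun n => zetaPow k n * ramanujanProd s n *
      Φ (n / (x / (p ^ j : ℕ)))) (x / (p ^ j : ℕ)) =
      summatory (fun n => (if p ^ j ∣ n then zetaPow k (n / p ^ j) else 0) *
        ramanujanProd s n * Φ (n / x)) x := by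
    intro j
    have hpj : 0 < p ^ j := pow_pos hp.pos j
    rw [← summatory_dvd hpj]
    refine Finset.sum_congr rfl fun n _ => ?_
    dsimp only
    split_ifs with h
    · obtain ⟨m, rfl⟩ := h
      rw [Nat.mul_div_cancel_left m hpj]
      have e1 : ramanujanProd s (p ^ j * m) = ramanujanProd s m := by
        refine Finset.prod_congr rfl fun r hr => ?_
        have hrp : r.Coprime (p ^ j) := Nat.Coprime.pow_right j
          ((Nat.coprime_primes (hs r hr) hp).2 fun h => hps (h ▸ hr))
        simp only [hrp.dvd_mul_left]
      have e2 : ((p ^ j * m : ℕ) : ℝ) / x = m / (x / (p ^ j : ℕ)) := by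
        push_cast; field_simp
      rw [e1, e2]
    · simp
  simp only [localOp, hstep]
  simp only [summatory, Finset.mul_sum]
  rw [Finset.sum_comm, ← Finset.sum_sub_distrib]
  refine Finset.sum_congr rfl fun n _ => ?_
  have h1 := zetaPow_coprime_part hp k n
  have e : ∑ j ∈ Finset.range (k + 1), (p : ℝ) * ((-1 : ℝ) ^ j * k.choose j *
      ((if p ^ j ∣ n then zetaPow k (n / p ^ j) else 0) * ramanujanProd s n * Φ (n / x))) =
      p * (if p ∣ n then 0 else zetaPow k n) * (ramanujanProd s n * Φ (n / x)) := by
    rw [h1, Finset.mul_sum, Finset.sum_mul]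
    exact Finset.sum_congr rfl fun j _ => by ring
  rw [e, ramanujanProd, Finset.prod_insert hps, ← ramanujanProd]
  split_ifs <;> ring

/-- The `j = 0` term cancels `p G(x)`, leaving `-G(x)`. For `j ≥ 1` the weight `p` is nearly
absorbed by the dilation: `p (x/p)^(1-η) = p^η x^(1-η)`. -/
theorem abs_localOp_le {k p : ℕ} (hp : 1 ≤ p) {G : ℝ → ℝ} {B η : ℝ} (hB : 0 ≤ B) (hη : η < 1)
    (h : ∀ x, 0 < x → |G x| ≤ B * x ^ (1 - η)) {x : ℝ} (hx : 0 < x) :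
    |localOp k p G x| ≤ B * (1 + 2 ^ k * (p : ℝ) ^ η) * x ^ (1 - η) := by
  have hp1 : (1 : ℝ) ≤ p := by exact_mod_cast hp
  have hp0 : (0 : ℝ) < p := by linarith
  have e : localOp k p G x = -G x - p * ∑ j ∈ Finset.range k,
      (-1 : ℝ) ^ (j + 1) * k.choose (j + 1) * G (x / (p ^ (j + 1) : ℕ)) := by
    rw [localOp, Finset.sum_range_succ']
    simp
    ring
  have hj : ∀ j ∈ Finset.range k, |(-1 : ℝ) ^ (j + 1) * k.choose (j + 1) *
      G (x / (p ^ (j + 1) : ℕ))| ≤ k.choose (j + 1) * (B * (x / p) ^ (1 - η)) := by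
    intro j _
    rw [abs_mul, abs_mul, abs_pow, abs_neg, abs_one, one_pow, one_mul, Nat.abs_cast]
    refine mul_le_mul_of_nonneg_left ((h _ (by positivity)).trans ?_) (by positivity)
    refine mul_le_mul_of_nonneg_left (rpow_le_rpow (by positivity) ?_ (by linarith)) hB
    refine div_le_div_of_nonneg_left hx.le hp0 ?_
    push_cast
    exact le_self_pow₀ hp1 j.succ_ne_zero
  have hch : ∑ j ∈ Finset.range k, (k.choose (j + 1) : ℝ) ≤ 2 ^ k := by
    have := Nat.sum_range_choose k
    rw [Finset.sum_range_succ'] at this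
    have h2 : ∑ j ∈ Finset.range k, k.choose (j + 1) ≤ 2 ^ k := by omega
    exact_mod_cast h2
  have hsum : |∑ j ∈ Finset.range k, (-1 : ℝ) ^ (j + 1) * k.choose (j + 1) *
      G (x / (p ^ (j + 1) : ℕ))| ≤ 2 ^ k * (B * (x / p) ^ (1 - η)) :=
    ((Finset.abs_sum_le_sum_abs _ _).trans (Finset.sum_le_sum hj)).trans (by
      rw [← Finset.sum_mul]
      exact mul_le_mul_of_nonneg_right hch (by positivity))
  have hpow : p * (x / p) ^ (1 - η) = (p : ℝ) ^ η * x ^ (1 - η) := by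
    rw [div_rpow hx.le hp0.le, rpow_sub hp0, rpow_one]
    field_simp
  calc |localOp k p G x| ≤ |G x| + p * |∑ j ∈ Finset.range k, (-1 : ℝ) ^ (j + 1) *
        k.choose (j + 1) * G (x / (p ^ (j + 1) : ℕ))| := by
        rw [e]
        refine (abs_sub _ _).trans ?_
        rw [abs_neg, abs_mul, Nat.abs_cast]
    _ ≤ B * x ^ (1 - η) + p * (2 ^ k * (B * (x / p) ^ (1 - η))) :=
        add_le_add (h x hx) (mul_le_mul_of_nonneg_left hsum hp0.le)
    _ = B * x ^ (1 - η) + 2 ^ k * B * (p * (x / p) ^ (1 - η)) := by ring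
    _ = _ := by rw [hpow]; ring

/-! ### Formal power series for the main term -/

/-- The power series of `exp (a u)`. -/
noncomputable def expSeries (a : ℝ) : PowerSeries ℝ := PowerSeries.rescale a (PowerSeries.exp ℝ)

theorem coeff_expSeries (a : ℝ) (n : ℕ) :
    PowerSeries.coeff n (expSeries a) = a ^ n / (n.factorial : ℝ) := by
  rw [expSeries, PowerSeries.coeff_rescale, PowerSeries.coeff_exp]
  simp [div_eq_mul_inv]

theorem expSeries_add (a b : ℝ) : expSeries (a + b) = expSeries a * expSeries b :=
  (PowerSeries.exp_mul_exp_eq_exp_add a b).symm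

theorem expSeries_zero : expSeries 0 = 1 := by
  ext n
  rw [coeff_expSeries, PowerSeries.coeff_one]
  split_ifs with h
  · simp [h]
  · simp [h]

theorem expSeries_nat_mul (n : ℕ) (a : ℝ) : expSeries (n * a) = expSeries a ^ n := by
  induction n with
  | zero => simp [expSeries_zero]
  | succ n ih => rw [pow_succ, ← ih, ← expSeries_add]; congr 1; push_cast; ring

theorem rescale_expSeries (a b : ℝ) : PowerSeries.rescale a (expSeries b) = expSeries (a * b) := by
  ext n
  rw [PowerSeries.coeff_rescale, coeff_expSeries, coeff_expSeries, mul_pow]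
  ring

/-- The constant term of `Q(d/du) A(u)`, for `Q` of degree at most `m`. -/
noncomputable def diffPairing (m : ℕ) (Q : Polynomial ℝ) (A : PowerSeries ℝ) : ℝ :=
  ∑ i ∈ Finset.range (m + 1), i.factorial * PowerSeries.coeff i A * Q.coeff i

theorem diffPairing_expSeries {m : ℕ} {Q : Polynomial ℝ} (hQ : Q.natDegree ≤ m) (x : ℝ) :
    diffPairing m Q (expSeries x) = Q.eval x := by
  rw [Polynomial.eval_eq_sum_range' (n := m + 1) (by omega), diffPairing]
  refine Finset.sum_congr rfl fun i _ => ?_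
  rw [coeff_expSeries]
  have : (i.factorial : ℝ) ≠ 0 := by exact_mod_cast i.factorial_ne_zero
  field_simp

theorem diffPairing_sub (m : ℕ) (Q : Polynomial ℝ) (A B : PowerSeries ℝ) :
    diffPairing m Q (A - B) = diffPairing m Q A - diffPairing m Q B := by
  simp only [diffPairing, map_sub, mul_sub, sub_mul, Finset.sum_sub_distrib]

theorem diffPairing_C_mul (m : ℕ) (Q : Polynomial ℝ) (c : ℝ) (A : PowerSeries ℝ) :
    diffPairing m Q (PowerSeries.C c * A) = c * diffPairing m Q A := by
  simp only [diffPairing, PowerSeries.coeff_C_mul, Finset.mul_sum]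
  exact Finset.sum_congr rfl fun _ _ => by ring

theorem diffPairing_sum (m : ℕ) (Q : Polynomial ℝ) {ι : Type*} (s : Finset ι)
    (A : ι → PowerSeries ℝ) :
    diffPairing m Q (∑ j ∈ s, A j) = ∑ j ∈ s, diffPairing m Q (A j) := by
  simp only [diffPairing, map_sum, Finset.mul_sum, Finset.sum_mul]
  exact Finset.sum_comm

/-- The power series of `(p - 1) - p (1 - e^{-u} / p)ᵏ`. -/
noncomputable def localSeries (k p : ℕ) : PowerSeries ℝ :=
  PowerSeries.C ((p : ℝ) - 1) -
    PowerSeries.C (p : ℝ) * (1 - PowerSeries.C (1 / (p : ℝ)) * expSeries (-1)) ^ k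

theorem rescale_localSeries (k p : ℕ) (r : ℝ) :
    PowerSeries.rescale r (localSeries k p) =
      PowerSeries.C ((p : ℝ) - 1) -
        PowerSeries.C (p : ℝ) * (1 - PowerSeries.C (1 / (p : ℝ)) * expSeries (-r)) ^ k := by
  have hC : ∀ c : ℝ, PowerSeries.rescale r (PowerSeries.C c) = PowerSeries.C c := fun c => by
    ext n
    rw [PowerSeries.coeff_rescale, PowerSeries.coeff_C]
    split_ifs with h <;> simp [h]
  simp only [localSeries, map_sub, map_mul, map_pow, map_one, rescale_expSeries, hC]
  simp

/-- Dilating `x` by `p^j` multiplies `x e^{u log x}` by `p^{-j} e^{-ju log p}`; summing binomially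
gives the local series at `u log p`. -/
theorem localOp_mul_diffPairing {k m p : ℕ} (hp : 0 < p) (Q : Polynomial ℝ) (A : PowerSeries ℝ)
    {x : ℝ} (hx : 0 < x) :
    localOp k p (fun x => x * diffPairing m Q (A * expSeries (log x))) x =
      x * diffPairing m Q
        (PowerSeries.rescale (log p) (localSeries k p) * A * expSeries (log x)) := by
  have hp0 : (p : ℝ) ≠ 0 := by positivity
  have e : PowerSeries.rescale (log p) (localSeries k p) * A * expSeries (log x) =
      PowerSeries.C ((p : ℝ) - 1) * (A * expSeries (log x)) -
      PowerSeries.C (p : ℝ) * ∑ j ∈ Finset.range (k + 1),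
        PowerSeries.C ((-1 : ℝ) ^ j * k.choose j * (1 / (p : ℝ)) ^ j) *
          (A * expSeries (log (x / (p ^ j : ℕ)))) := by
    rw [rescale_localSeries, sub_eq_add_neg (1 : PowerSeries ℝ), add_comm (1 : PowerSeries ℝ),
      add_pow, sub_mul, sub_mul, mul_assoc]
    congr 1
    rw [mul_assoc, mul_assoc]
    congr 1
    rw [Finset.sum_mul]
    refine Finset.sum_congr rfl fun j _ => ?_
    have hlog : log (x / (p ^ j : ℕ)) = j * (-log p) + log x := by
      push_cast
      rw [log_div hx.ne' (by positivity), log_pow]; ring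
    rw [hlog, expSeries_add, expSeries_nat_mul, neg_pow, mul_pow]
    simp only [map_mul, map_pow, map_neg, map_one, map_natCast, one_pow]
    ring
  rw [e, diffPairing_sub, diffPairing_C_mul, diffPairing_C_mul, diffPairing_sum]
  simp only [diffPairing_C_mul, localOp, Finset.mul_sum]
  rw [mul_sub, Finset.mul_sum]
  congr 1
  · ring
  · refine Finset.sum_congr rfl fun j _ => ?_
    rw [one_div, inv_pow]
    push_cast
    field_simp

theorem abs_summatory_ramanujanProd_sub_le {k m : ℕ} {Φ : ℝ → ℝ} {Q : Polynomial ℝ}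
    (hQ : Q.natDegree ≤ m) {η C : ℝ} (hη : η < 1) (hC : 0 ≤ C)
    (h : ∀ x : ℝ, 0 < x →
      |summatory (fun n => zetaPow k n * Φ (n / x)) x - x * Q.eval (log x)| ≤ C * x ^ (1 - η))
    (s : Finset ℕ) (hs : ∀ p ∈ s, p.Prime) (x : ℝ) (hx : 0 < x) :
    |summatory (fun n => zetaPow k n * ramanujanProd s n * Φ (n / x)) x -
      x * diffPairing m Q
        ((∏ p ∈ s, PowerSeries.rescale (log p) (localSeries k p)) * expSeries (log x))| ≤
      C * (∏ p ∈ s, (1 + 2 ^ k * (p : ℝ) ^ η)) * x ^ (1 - η) := by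
  induction s using Finset.induction_on generalizing x with
  | empty => simpa [ramanujanProd, diffPairing_expSeries hQ] using h x hx
  | insert p s hps ih =>
    have hs' : ∀ r ∈ s, r.Prime := fun r hr => hs r (Finset.mem_insert_of_mem hr)
    have hp := hs p (Finset.mem_insert_self p s)
    rw [summatory_ramanujanProd_insert hp hs' hps Φ hx, Finset.prod_insert hps,
      Finset.prod_insert hps, ← localOp_mul_diffPairing hp.pos Q _ hx, ← localOp_sub]
    refine (abs_localOp_le hp.one_le (B := C * ∏ p ∈ s, (1 + 2 ^ k * (p : ℝ) ^ η))
      (by positivity) hη (fun y hy => ih hs' y hy) hx).trans_eq ?_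
    ring

/-! ### A submultiplicative norm on truncated series -/

/-- The `ℓ¹` norm of the coefficients up to degree `m`. -/
noncomputable def truncNorm (m : ℕ) (A : PowerSeries ℝ) : ℝ :=
  ∑ i ∈ Finset.range (m + 1), |PowerSeries.coeff i A|

namespace truncNorm

variable (m : ℕ)

theorem nonneg (A : PowerSeries ℝ) : 0 ≤ truncNorm m A :=
  Finset.sum_nonneg fun _ _ => abs_nonneg _

theorem abs_coeff_le {i : ℕ} (hi : i ≤ m) (A : PowerSeries ℝ) :
    |PowerSeries.coeff i A| ≤ truncNorm m A :=
  Finset.single_le_sum (f := fun i => |PowerSeries.coeff i A|) (fun _ _ => abs_nonneg _)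
    (Finset.mem_range.2 (by omega))

theorem add_le (A B : PowerSeries ℝ) : truncNorm m (A + B) ≤ truncNorm m A + truncNorm m B := by
  simp only [truncNorm, ← Finset.sum_add_distrib, map_add]
  exact Finset.sum_le_sum fun _ _ => abs_add_le _ _

theorem neg (A : PowerSeries ℝ) : truncNorm m (-A) = truncNorm m A := by
  simp [truncNorm]

theorem sub_le (A B : PowerSeries ℝ) : truncNorm m (A - B) ≤ truncNorm m A + truncNorm m B := by
  rw [sub_eq_add_neg, ← neg m B]
  exact add_le m A (-B)

theorem C_mul (c : ℝ) (A : PowerSeries ℝ) :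
    truncNorm m (PowerSeries.C c * A) = |c| * truncNorm m A := by
  simp only [truncNorm, PowerSeries.coeff_C_mul, abs_mul, Finset.mul_sum]

theorem one : truncNorm m 1 = 1 := by
  rw [truncNorm, Finset.sum_eq_single 0]
  · simp
  · intro i _ hi
    simp [PowerSeries.coeff_one, hi]
  · simp

theorem mul_le (A B : PowerSeries ℝ) : truncNorm m (A * B) ≤ truncNorm m A * truncNorm m B := by
  set R := Finset.range (m + 1)
  set f : ℕ × ℕ → ℝ := fun x => |PowerSeries.coeff x.1 A| * |PowerSeries.coeff x.2 B|
  calc truncNorm m (A * B) ≤ ∑ i ∈ R, ∑ x ∈ Finset.HasAntidiagonal.antidiagonal i, f x := by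
        refine Finset.sum_le_sum fun i _ => ?_
        rw [PowerSeries.coeff_mul]
        refine (Finset.abs_sum_le_sum_abs _ _).trans_eq ?_
        exact Finset.sum_congr rfl fun x _ => abs_mul _ _
    _ = ∑ i ∈ R, ∑ x ∈ ((R ×ˢ R).filter fun x => x.1 + x.2 ∈ R) with x.1 + x.2 = i, f x := by
        refine Finset.sum_congr rfl fun i hi => Finset.sum_congr ?_ fun _ _ => rfl
        ext x
        simp only [R, Finset.HasAntidiagonal.mem_antidiagonal, Finset.mem_filter, Finset.mem_product,
          Finset.mem_range] at hi ⊢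
        omega
    _ = ∑ x ∈ (R ×ˢ R).filter fun x => x.1 + x.2 ∈ R, f x :=
        Finset.sum_fiberwise_of_maps_to (fun x hx => (Finset.mem_filter.1 hx).2) _
    _ ≤ ∑ x ∈ R ×ˢ R, f x :=
        Finset.sum_le_sum_of_subset_of_nonneg (Finset.filter_subset _ _)
          fun _ _ _ => mul_nonneg (abs_nonneg _) (abs_nonneg _)
    _ = truncNorm m A * truncNorm m B := by
        rw [truncNorm, truncNorm, Finset.sum_mul_sum, Finset.sum_product]

theorem pow_le (A : PowerSeries ℝ) (n : ℕ) : truncNorm m (A ^ n) ≤ truncNorm m A ^ n := by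
  induction n with
  | zero => simp [one]
  | succ n ih =>
    rw [pow_succ, pow_succ]
    exact (mul_le m _ _).trans (mul_le_mul_of_nonneg_right ih (nonneg m A))

theorem sum_le {ι : Type*} (s : Finset ι) (A : ι → PowerSeries ℝ) :
    truncNorm m (∑ i ∈ s, A i) ≤ ∑ i ∈ s, truncNorm m (A i) := by
  simp only [truncNorm, map_sum]
  rw [Finset.sum_comm]
  exact Finset.sum_le_sum fun _ _ => Finset.abs_sum_le_sum_abs _ _

theorem expSeries_le (a : ℝ) : truncNorm m (expSeries a) ≤ exp |a| := by
  refine le_trans (le_of_eq ?_) (Real.sum_le_exp_of_nonneg (abs_nonneg a) (m + 1))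
  refine Finset.sum_congr rfl fun i _ => ?_
  rw [coeff_expSeries, abs_div, abs_pow, Nat.abs_cast]

/-- The quadratic gain `r ^ 2` is what makes the corrections summable when every prime of `q` is a
small power of `N`. -/
theorem rescale_le {r : ℝ} (hr0 : 0 ≤ r) (hr1 : r ≤ 1) {A : PowerSeries ℝ}
    (h0 : PowerSeries.coeff 0 A = 0) (h1 : PowerSeries.coeff 1 A = 0) :
    truncNorm m (PowerSeries.rescale r A) ≤ r ^ 2 * truncNorm m A := by
  rw [truncNorm, truncNorm, Finset.mul_sum]
  refine Finset.sum_le_sum fun i _ => ?_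
  rw [PowerSeries.coeff_rescale, abs_mul, abs_of_nonneg (pow_nonneg hr0 i)]
  rcases Nat.lt_or_ge i 2 with hi | hi
  · interval_cases i <;> simp [h0, h1]
  · exact mul_le_mul_of_nonneg_right (pow_le_pow_of_le_one hr0 hr1 hi) (abs_nonneg _)

theorem prod_one_add_sub_one_le {ι : Type*} (s : Finset ι) (E : ι → PowerSeries ℝ) :
    truncNorm m (∏ i ∈ s, (1 + E i) - 1) ≤ exp (∑ i ∈ s, truncNorm m (E i)) - 1 := by
  classical
  induction s using Finset.induction_on with
  | empty => simp [truncNorm]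
  | insert a s ha ih =>
    rw [Finset.prod_insert ha, Finset.sum_insert ha, exp_add]
    set P := ∏ i ∈ s, (1 + E i) - 1 with hP
    set t := truncNorm m (E a)
    have ht : 0 ≤ t := nonneg m _
    have e : (1 + E a) * ∏ i ∈ s, (1 + E i) - 1 = P + (E a + E a * P) := by rw [hP]; ring
    have h1 : truncNorm m ((1 + E a) * ∏ i ∈ s, (1 + E i) - 1) ≤
        truncNorm m P + (t + t * truncNorm m P) := by
      rw [e]
      exact (add_le m _ _).trans (add_le_add_right ((add_le m _ _).trans
        (add_le_add_right (mul_le m _ _) _)) _)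
    have h2 := add_one_le_exp t
    have h3 := exp_pos (∑ i ∈ s, truncNorm m (E i))
    nlinarith

end truncNorm

/-! ### Local factors and their product over the primes of `q` -/

theorem coeff_zero_mul_eq (A B : PowerSeries ℝ) :
    PowerSeries.coeff 0 (A * B) = PowerSeries.coeff 0 A * PowerSeries.coeff 0 B := by
  simp

theorem coeff_one_mul_eq (A B : PowerSeries ℝ) : PowerSeries.coeff 1 (A * B) =
    PowerSeries.coeff 0 A * PowerSeries.coeff 1 B + PowerSeries.coeff 1 A * PowerSeries.coeff 0 B := by
  rw [PowerSeries.coeff_mul, Finset.Nat.antidiagonal_succ]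
  simp

section localSeries

variable {m p : ℕ}

theorem coeff_zero_localSeries (hp : p ≠ 0) :
    PowerSeries.coeff 0 (localSeries (m + 1) p) =
      (1 - 1 / (p : ℝ)) * ∑ j ∈ Finset.range m, (1 - 1 / (p : ℝ)) ^ j := by
  have hp0 : (p : ℝ) ≠ 0 := by exact_mod_cast hp
  have h : PowerSeries.coeff 0 (localSeries (m + 1) p) =
      (p - 1) - p * (1 - 1 / (p : ℝ)) ^ (m + 1) := by
    have : PowerSeries.constantCoeff (expSeries (-1)) = 1 := by
      have := coeff_expSeries (-1) 0
      simpa using this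
    simp [localSeries, this]
  rw [h]
  have hg := mul_neg_geom_sum (1 - 1 / (p : ℝ)) m
  have e : ((p : ℝ) - 1) = p * (1 - 1 / p) := by field_simp
  have e2 : p * (1 - (1 - 1 / (p : ℝ))) = 1 := by field_simp; ring
  calc ((p : ℝ) - 1) - p * (1 - 1 / (p : ℝ)) ^ (m + 1)
      = (1 - 1 / (p : ℝ)) * (p * (1 - (1 - 1 / (p : ℝ)) ^ m)) := by rw [e, pow_succ]; ring
    _ = (1 - 1 / (p : ℝ)) * ((p * (1 - (1 - 1 / (p : ℝ)))) *
        ∑ j ∈ Finset.range m, (1 - 1 / (p : ℝ)) ^ j) := by rw [← hg]; ring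
    _ = _ := by rw [e2, one_mul]

theorem coeff_one_localSeries (hp : p ≠ 0) :
    PowerSeries.coeff 1 (localSeries (m + 1) p) = -((m + 1) * (1 - 1 / (p : ℝ)) ^ m) := by
  have hp0 : (p : ℝ) ≠ 0 := by exact_mod_cast hp
  have h0 : PowerSeries.coeff 0 (1 - PowerSeries.C (1 / (p : ℝ)) * expSeries (-1)) =
      1 - 1 / (p : ℝ) := by
    have := coeff_expSeries (-1) 0
    rw [map_sub, PowerSeries.coeff_C_mul, this]
    simp
  have h1 : PowerSeries.coeff 1 (1 - PowerSeries.C (1 / (p : ℝ)) * expSeries (-1)) =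
      1 / (p : ℝ) := by
    have := coeff_expSeries (-1) 1
    rw [map_sub, PowerSeries.coeff_C_mul, this]
    simp [PowerSeries.coeff_one]
  have hC : PowerSeries.coeff 1 (PowerSeries.C ((p : ℝ) - 1)) = 0 := by
    rw [PowerSeries.coeff_C, if_neg one_ne_zero]
  rw [localSeries, map_sub, PowerSeries.coeff_C_mul, PowerSeries.coeff_one_pow, h1, hC]
  rw [PowerSeries.coeff_zero_eq_constantCoeff_apply] at h0
  rw [h0, Nat.add_sub_cancel]
  push_cast
  field_simp
  ring

theorem half_le_one_sub_one_div (hp : p.Prime) : (1 : ℝ) / 2 ≤ 1 - 1 / (p : ℝ) := by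
  have : (2 : ℝ) ≤ p := by exact_mod_cast hp.two_le
  have : 1 / (p : ℝ) ≤ 1 / 2 := one_div_le_one_div_of_le (by norm_num) this
  linarith

/-- The geometric sum for the constant term has `m` terms, each at least the smallest power `(1 -
1/p)^m`. The factor `m` is the source of `d_{k-1}(q)`. -/
theorem le_coeff_zero_localSeries (hp : p.Prime) :
    m * (1 - 1 / (p : ℝ)) ^ m ≤ PowerSeries.coeff 0 (localSeries (m + 1) p) := by
  rw [coeff_zero_localSeries hp.ne_zero]
  have h1 := half_le_one_sub_one_div hp
  have h2 : 1 - 1 / (p : ℝ) ≤ 1 := by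
    have : (0 : ℝ) ≤ 1 / p := by positivity
    linarith
  set x := 1 - 1 / (p : ℝ)
  have hx : 0 ≤ x := by linarith
  rw [Finset.mul_sum]
  calc m * x ^ m = ∑ j ∈ Finset.range m, x ^ m := by simp
    _ ≤ _ := by
      refine Finset.sum_le_sum fun j hj => ?_
      rw [← pow_succ']
      exact pow_le_pow_of_le_one hx h2 (Finset.mem_range.1 hj)

theorem coeff_zero_localSeries_pos (hm : 1 ≤ m) (hp : p.Prime) :
    0 < PowerSeries.coeff 0 (localSeries (m + 1) p) := by
  refine lt_of_lt_of_le ?_ (le_coeff_zero_localSeries hp)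
  have h1 := half_le_one_sub_one_div hp
  have hm' : (0 : ℝ) < m := by exact_mod_cast hm
  have : 0 < 1 - 1 / (p : ℝ) := by linarith
  positivity

theorem half_pow_le_coeff_zero_localSeries (hm : 1 ≤ m) (hp : p.Prime) :
    (1 / 2) ^ m ≤ PowerSeries.coeff 0 (localSeries (m + 1) p) := by
  refine le_trans ?_ (le_coeff_zero_localSeries hp)
  have h1 := half_le_one_sub_one_div hp
  have hm' : (1 : ℝ) ≤ m := by exact_mod_cast hm
  calc (1 / 2 : ℝ) ^ m ≤ (1 - 1 / (p : ℝ)) ^ m := pow_le_pow_left₀ (by norm_num) h1 m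
    _ ≤ _ := le_mul_of_one_le_left (pow_nonneg (by linarith) _) hm'

theorem truncNorm_localSeries_le (n k : ℕ) (hp : p.Prime) :
    truncNorm n (localSeries k p) ≤ 1 + 3 * (k * 4 ^ k) := by
  have hp1 : (1 : ℝ) ≤ p := by exact_mod_cast hp.one_le
  have hp0 : (0 : ℝ) < p := by linarith
  set y := PowerSeries.C (1 / (p : ℝ)) * expSeries (-1)
  have hy : truncNorm n y ≤ 3 / p := by
    rw [truncNorm.C_mul, abs_of_pos (by positivity), one_div_mul_eq_div]
    refine div_le_div_of_nonneg_right ((truncNorm.expSeries_le n _).trans ?_) hp0.le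
    rw [abs_neg, abs_one]
    exact exp_one_lt_three.le
  have hy3 : truncNorm n y ≤ 3 := hy.trans (div_le_self (by norm_num) hp1)
  -- Factoring `1 - (1 - y)^k` extracts one `y` of norm `O(1/p)`, which offsets the coefficient `p`
  -- and makes the bound uniform in `p`.
  have e : localSeries k p = PowerSeries.C (p : ℝ) * (y * ∑ i ∈ Finset.range k, (1 - y) ^ i) - 1 := by
    have := mul_neg_geom_sum (1 - y) k
    rw [sub_sub_cancel] at this
    rw [this, localSeries, map_sub, map_one]
    ring
  have h1y : truncNorm n (1 - y) ≤ 4 := by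
    have := truncNorm.sub_le n 1 y
    rw [truncNorm.one] at this
    linarith
  have hs : truncNorm n (∑ i ∈ Finset.range k, (1 - y) ^ i) ≤ k * 4 ^ k := by
    refine (truncNorm.sum_le n _ _).trans ?_
    calc ∑ i ∈ Finset.range k, truncNorm n ((1 - y) ^ i) ≤ ∑ i ∈ Finset.range k, (4 : ℝ) ^ k := by
          refine Finset.sum_le_sum fun i hi => (truncNorm.pow_le n _ i).trans ?_
          exact (pow_le_pow_left₀ (truncNorm.nonneg n _) h1y i).trans
            (pow_le_pow_right₀ (by norm_num) (Finset.mem_range.1 hi).le)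
      _ = _ := by simp
  rw [e]
  refine (truncNorm.sub_le n _ _).trans ?_
  rw [truncNorm.one, truncNorm.C_mul, abs_of_pos hp0, add_comm]
  refine add_le_add_right ?_ 1
  calc (p : ℝ) * truncNorm n (y * ∑ i ∈ Finset.range k, (1 - y) ^ i)
      ≤ p * ((3 / p) * (k * 4 ^ k)) := by
        refine mul_le_mul_of_nonneg_left ((truncNorm.mul_le n _ _).trans ?_) hp0.le
        exact mul_le_mul hy hs (truncNorm.nonneg n _) (by positivity)
    _ = _ := by field_simp

/-- A local factor is a constant times an exponential times a series that is `1` up to second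
order. -/
theorem exists_localSeries_factorization (hm : 1 ≤ m) (hp : p.Prime) :
    ∃ α : ℝ, 0 ≤ α ∧ α ≤ 2 ∧ ∃ E : PowerSeries ℝ, PowerSeries.coeff 0 E = 0 ∧
      PowerSeries.coeff 1 E = 0 ∧
      truncNorm m E ≤ 1 + 2 ^ m * (1 + 3 * ((m + 1 : ℕ) * 4 ^ (m + 1))) * exp 2 ∧
      localSeries (m + 1) p = PowerSeries.C (PowerSeries.coeff 0 (localSeries (m + 1) p)) *
        ((1 + E) * expSeries (-α)) := by
  set H := localSeries (m + 1) p
  set h := PowerSeries.coeff 0 H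
  have hh : 0 < h := coeff_zero_localSeries_pos hm hp
  have hx0 : 0 ≤ 1 - 1 / (p : ℝ) := by have := half_le_one_sub_one_div hp; linarith
  have h1 : PowerSeries.coeff 1 H = -((m + 1) * (1 - 1 / (p : ℝ)) ^ m) :=
    coeff_one_localSeries hp.ne_zero
  have hm' : (1 : ℝ) ≤ m := by exact_mod_cast hm
  set t := (1 - 1 / (p : ℝ)) ^ m
  have ht : 0 ≤ t := pow_nonneg hx0 m
  have hth : m * t ≤ h := le_coeff_zero_localSeries hp
  -- Minus the logarithmic derivative of the local series at `0`, so that the linear term cancels.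
  -- It is at most `2` because `h ≥ m t` and `m + 1 ≤ 2 m`.
  set α := (m + 1) * t / h
  have hα0 : 0 ≤ α := by positivity
  have hα2 : α ≤ 2 := by
    rw [div_le_iff₀ hh]
    nlinarith
  have he0 : PowerSeries.coeff 0 (expSeries α) = 1 := by rw [coeff_expSeries]; simp
  have he1 : PowerSeries.coeff 1 (expSeries α) = α := by rw [coeff_expSeries]; simp
  refine ⟨α, hα0, hα2, PowerSeries.C (1 / h) * (H * expSeries α) - 1, ?_, ?_, ?_, ?_⟩
  · rw [map_sub, PowerSeries.coeff_C_mul, coeff_zero_mul_eq, he0]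
    change 1 / h * (h * 1) - _ = 0
    simp [hh.ne']
  · rw [map_sub, PowerSeries.coeff_C_mul, coeff_one_mul_eq, he0, he1, h1]
    change 1 / h * (h * α + _) - _ = 0
    simp only [α, PowerSeries.coeff_one]
    field_simp
    simp
  · refine (truncNorm.sub_le m _ _).trans ?_
    rw [truncNorm.one, truncNorm.C_mul, abs_of_pos (by positivity), add_comm]
    refine add_le_add_right ?_ 1
    rw [mul_assoc]
    refine mul_le_mul ?_ ((truncNorm.mul_le m _ _).trans (mul_le_mul
      (truncNorm_localSeries_le m (m + 1) hp) ((truncNorm.expSeries_le m α).trans ?_)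
      (truncNorm.nonneg m _) (by positivity))) (truncNorm.nonneg m _) (by positivity)
    · have := half_pow_le_coeff_zero_localSeries hm hp
      calc 1 / h ≤ 1 / (1 / 2) ^ m := one_div_le_one_div_of_le (by positivity) this
        _ = 2 ^ m := by simp
    · rw [abs_of_nonneg hα0]; exact exp_le_exp.2 hα2
  · have e : expSeries α * expSeries (-α) = 1 := by
      rw [← expSeries_add, add_neg_cancel, expSeries_zero]
    have e2 : PowerSeries.C h * PowerSeries.C (1 / h) = 1 := by
      rw [← map_mul, mul_one_div_cancel hh.ne', map_one]
    calc H = (PowerSeries.C h * PowerSeries.C (1 / h)) * H * (expSeries α * expSeries (-α)) := by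
          rw [e, e2, one_mul, mul_one]
      _ = _ := by ring

/-- After rescaling by `1/L`, the series is `h (1 + R) e^{lam·u}` with `δ ≤ lam ≤ 1` and `R` small.
The coefficient of `u^m` is then at least `h (δ^m / m!)` minus half of that. -/
theorem exists_coeff_prod_localSeries_bounds (hm : 1 ≤ m) {δ : ℝ} (hδ : 0 < δ) :
    ∃ c : ℝ, 0 < c ∧ ∃ M : ℝ, 0 ≤ M ∧ ∀ s : Finset ℕ, (∀ p ∈ s, p.Prime) → ∀ L : ℝ, 0 < L →
      (∀ p ∈ s, log p ≤ c * L) → ∑ p ∈ s, log p ≤ (1 / 2 - δ / 2) * L →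
      δ ^ m / (2 * m.factorial) * (∏ p ∈ s, PowerSeries.coeff 0 (localSeries (m + 1) p)) * L ^ m ≤
        PowerSeries.coeff m ((∏ p ∈ s, PowerSeries.rescale (log p) (localSeries (m + 1) p)) *
          expSeries L) ∧
      ∀ i ≤ m, |PowerSeries.coeff i ((∏ p ∈ s, PowerSeries.rescale (log p)
        (localSeries (m + 1) p)) * expSeries L)| ≤
          M * (∏ p ∈ s, PowerSeries.coeff 0 (localSeries (m + 1) p)) * L ^ i := by
  set B : ℝ := 1 + 2 ^ m * (1 + 3 * ((m + 1 : ℕ) * 4 ^ (m + 1))) * exp 2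
  have hB : 0 < B := by positivity
  -- Chosen so that `κ e`, a bound for the norm of `R e^{lam·u}`, is half of `δ^m / m!`.
  set κ : ℝ := δ ^ m / (2 * m.factorial * exp 1)
  have hκ : 0 < κ := by positivity
  have hlogκ : 0 < log (1 + κ) := log_pos (by linarith)
  -- The bound `1` permits the quadratic gain in `rescale_le`; the other makes `exp (B c) - 1 ≤ κ`.
  set c : ℝ := min 1 (log (1 + κ) / B)
  have hc : 0 < c := lt_min one_pos (by positivity)
  have hBc : exp (B * c) - 1 ≤ κ := by
    have h1 : B * c ≤ log (1 + κ) := by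
      have := min_le_right 1 (log (1 + κ) / B)
      rw [mul_comm]
      exact (le_div_iff₀ hB).1 this
    have := exp_le_exp.2 h1
    rw [exp_log (by linarith)] at this
    linarith
  refine ⟨c, hc, (1 + κ) * exp 1, by positivity, fun s hs L hL hcL hsum => ?_⟩
  choose! α hα0 hα2 E hE0 hE1 hEn hfac using
    fun p (hp : p ∈ s) => exists_localSeries_factorization hm (hs p hp)
  have hlog : ∀ p ∈ s, 0 ≤ log (p : ℝ) := fun p hp =>
    log_nonneg (by exact_mod_cast (hs p hp).one_le)
  set r : ℕ → ℝ := fun p => log p / L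
  have hr0 : ∀ p ∈ s, 0 ≤ r p := fun p hp => div_nonneg (hlog p hp) hL.le
  have hrc : ∀ p ∈ s, r p ≤ c := fun p hp => (div_le_iff₀ hL).2 (hcL p hp)
  have hrsum : ∑ p ∈ s, r p ≤ 1 / 2 - δ / 2 := by
    rw [← Finset.sum_div]; exact (div_le_iff₀ hL).2 hsum
  set h := ∏ p ∈ s, PowerSeries.coeff 0 (localSeries (m + 1) p)
  have hh : 0 < h := Finset.prod_pos fun p hp => coeff_zero_localSeries_pos hm (hs p hp)
  -- The exponential rate left after all the factors `e^{-α_p u}`, in units of `L`. Since `α p ≤ 2`,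
  -- the loss is at most `2 (1/2 - δ/2) = 1 - δ`.
  set lam := 1 - ∑ p ∈ s, α p * r p
  have hlam1 : lam ≤ 1 := by
    have : 0 ≤ ∑ p ∈ s, α p * r p :=
      Finset.sum_nonneg fun p hp => mul_nonneg (hα0 p hp) (hr0 p hp)
    simp only [lam]; linarith
  have hlamδ : δ ≤ lam := by
    have : ∑ p ∈ s, α p * r p ≤ 2 * ∑ p ∈ s, r p := by
      rw [Finset.mul_sum]
      exact Finset.sum_le_sum fun p hp => mul_le_mul_of_nonneg_right (hα2 p hp) (hr0 p hp)
    simp only [lam]; linarith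
  set F : ℕ → PowerSeries ℝ := fun p => PowerSeries.rescale (r p) (E p)
  set R := ∏ p ∈ s, (1 + F p) - 1 with hR
  -- Each correction costs `B r_p² ≤ B c r_p`, and `∑ r_p ≤ 1`.
  have hRn : truncNorm m R ≤ κ := by
    refine (truncNorm.prod_one_add_sub_one_le m s F).trans (le_trans ?_ hBc)
    refine sub_le_sub_right (exp_le_exp.2 ?_) 1
    calc ∑ p ∈ s, truncNorm m (F p) ≤ ∑ p ∈ s, B * c * r p := by
          refine Finset.sum_le_sum fun p hp => ?_
          have hrp := hrc p hp
          have hr := hr0 p hp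
          refine (truncNorm.rescale_le m hr (hrp.trans (min_le_left _ _)) (hE0 p hp)
            (hE1 p hp)).trans ?_
          calc r p ^ 2 * truncNorm m (E p) ≤ (c * r p) * B := by
                refine mul_le_mul ?_ (hEn p hp) (truncNorm.nonneg m _) (by positivity)
                rw [sq]; exact mul_le_mul_of_nonneg_right hrp hr
            _ = _ := by ring
      _ = B * c * ∑ p ∈ s, r p := by rw [Finset.mul_sum]
      _ ≤ B * c := mul_le_of_le_one_right (by positivity) (by linarith)
  have hcomp : ∀ (a b : ℝ) (A : PowerSeries ℝ), PowerSeries.rescale a (PowerSeries.rescale b A) =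
      PowerSeries.rescale (a * b) A := fun a b A => by
    ext n; simp only [PowerSeries.coeff_rescale]; ring
  have hC : ∀ a b : ℝ, PowerSeries.rescale a (PowerSeries.C b) = PowerSeries.C b := fun a b => by
    ext n
    rw [PowerSeries.coeff_rescale, PowerSeries.coeff_C]
    split_ifs with h <;> simp [h]
  have hexpsum : ∀ t : Finset ℕ, ∏ p ∈ t, expSeries (-(α p * r p)) =
      expSeries (-∑ p ∈ t, α p * r p) := fun t => by
    induction t using Finset.induction_on with
    | empty => simp [expSeries_zero]
    | insert a t ha ih =>
      rw [Finset.prod_insert ha, Finset.sum_insert ha, ih, ← expSeries_add]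
      congr 1; ring
  set A := (∏ p ∈ s, PowerSeries.rescale (log p) (localSeries (m + 1) p)) * expSeries L
  have hA : PowerSeries.rescale (1 / L) A = PowerSeries.C h * (expSeries lam + R * expSeries lam) := by
    have e1 : ∀ p ∈ s, PowerSeries.rescale (1 / L)
        (PowerSeries.rescale (log p) (localSeries (m + 1) p)) =
        PowerSeries.C (PowerSeries.coeff 0 (localSeries (m + 1) p)) *
          ((1 + F p) * expSeries (-(α p * r p))) := fun p hp => by
      rw [hcomp]
      conv_lhs => rw [hfac p hp]
      rw [map_mul, map_mul, map_add, map_one, hC, rescale_expSeries]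
      have e : 1 / L * log p = r p := by simp only [r]; ring
      rw [e]
      congr 3
      ring
    rw [map_mul, map_prod, Finset.prod_congr rfl e1, Finset.prod_mul_distrib,
      Finset.prod_mul_distrib, hexpsum, rescale_expSeries, one_div_mul_cancel hL.ne', ← map_prod]
    have e2 : ∏ p ∈ s, (1 + F p) = 1 + R := by rw [hR]; ring
    have e3 : expSeries lam = expSeries (-∑ p ∈ s, α p * r p) * expSeries 1 := by
      rw [← expSeries_add]; congr 1; simp only [lam]; ring
    rw [e2, e3]
    ring
  have hcoeff : ∀ i, PowerSeries.coeff i A = L ^ i * (h * (PowerSeries.coeff i (expSeries lam) +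
      PowerSeries.coeff i (R * expSeries lam))) := fun i => by
    have := congrArg (PowerSeries.coeff i) hA
    rw [PowerSeries.coeff_rescale, PowerSeries.coeff_C_mul, map_add] at this
    rw [← this, ← mul_assoc, ← mul_pow, mul_one_div_cancel hL.ne', one_pow, one_mul]
  have hexp : truncNorm m (expSeries lam) ≤ exp 1 :=
    (truncNorm.expSeries_le m lam).trans (exp_le_exp.2 (abs_le.2 ⟨by linarith, hlam1⟩))
  have hRe : truncNorm m (R * expSeries lam) ≤ κ * exp 1 :=
    (truncNorm.mul_le m _ _).trans (mul_le_mul hRn hexp (truncNorm.nonneg m _) hκ.le)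
  constructor
  · rw [hcoeff, coeff_expSeries]
    have h1 := (abs_le.1 ((truncNorm.abs_coeff_le m le_rfl (R * expSeries lam)).trans hRe)).1
    have h2 : κ * exp 1 = δ ^ m / (2 * m.factorial) := by
      simp only [κ]; field_simp
    have h3 : δ ^ m / m.factorial ≤ lam ^ m / m.factorial :=
      div_le_div_of_nonneg_right (pow_le_pow_left₀ hδ.le hlamδ m) (by positivity)
    have h4 : δ ^ m / m.factorial = 2 * (δ ^ m / (2 * m.factorial)) := by field_simp
    have h5 : δ ^ m / (2 * m.factorial) ≤ lam ^ m / m.factorial +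
        PowerSeries.coeff m (R * expSeries lam) := by linarith
    calc δ ^ m / (2 * m.factorial) * h * L ^ m = L ^ m * (h * (δ ^ m / (2 * m.factorial))) := by
          ring
      _ ≤ _ := by gcongr
  · intro i hi
    rw [hcoeff, abs_mul, abs_mul, abs_of_pos hh, abs_of_pos (pow_pos hL i)]
    have h1 := (truncNorm.abs_coeff_le m hi (R * expSeries lam)).trans hRe
    have h2 := (truncNorm.abs_coeff_le m hi (expSeries lam)).trans hexp
    calc L ^ i * (h * |PowerSeries.coeff i (expSeries lam) +
          PowerSeries.coeff i (R * expSeries lam)|) ≤ L ^ i * (h * (exp 1 + κ * exp 1)) := by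
          gcongr
          exact (abs_add_le _ _).trans (add_le_add h2 h1)
      _ = _ := by ring

end localSeries

/-! ### Ramanujan sums at squarefree moduli -/

theorem sum_exp_eq_ite {q : ℕ} (hq : q ≠ 0) (n : ℕ) :
    ∑ a ∈ Finset.range q, Complex.exp (2 * Real.pi * Complex.I * ((a : ℂ) * (n : ℂ) / (q : ℂ))) =
      if q ∣ n then (q : ℂ) else 0 := by
  have hq0 : (q : ℂ) ≠ 0 := by exact_mod_cast hq
  have hprim := Complex.isPrimitiveRoot_exp q hq
  set z := Complex.exp (2 * Real.pi * Complex.I / q)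
  have hterm : ∀ a : ℕ, Complex.exp (2 * Real.pi * Complex.I * ((a : ℂ) * (n : ℂ) / (q : ℂ))) =
      (z ^ n) ^ a := fun a => by
    rw [← pow_mul, ← Complex.exp_nat_mul]
    congr 1
    push_cast
    ring
  simp only [hterm]
  split_ifs with h
  · rw [(hprim.pow_eq_one_iff_dvd n).2 h]
    simp
  · have h1 : z ^ n ≠ 1 := fun h' => h ((hprim.pow_eq_one_iff_dvd n).1 h')
    rw [geom_sum_eq h1, ← pow_mul, mul_comm, pow_mul, hprim.pow_eq_one]
    simp

/-- Grouping the residues `a` modulo `q` by `gcd(q, a)` splits the full exponential sum into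
Ramanujan sums modulo the divisors of `q`. -/
theorem sum_divisors_ramanujanSum {q : ℕ} (hq : q ≠ 0) (n : ℕ) :
    ∑ d ∈ q.divisors, ramanujanSum d n = if q ∣ n then (q : ℂ) else 0 := by
  rw [← sum_exp_eq_ite hq, ← Nat.sum_div_divisors q fun d => ramanujanSum d n,
    ← Finset.sum_fiberwise_of_maps_to (s := Finset.range q) (t := q.divisors) (g := fun a => q.gcd a)
      fun a _ => Nat.mem_divisors.2 ⟨Nat.gcd_dvd_left q a, hq⟩]
  refine Finset.sum_congr rfl fun d hd => ?_
  obtain ⟨e, rfl⟩ := (Nat.mem_divisors.1 hd).1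
  have hd0 : 0 < d := Nat.pos_of_ne_zero (left_ne_zero_of_mul hq)
  rw [Nat.mul_div_cancel_left e hd0, ramanujanSum]
  refine Finset.sum_bij' (fun b _ => d * b) (fun a _ => a / d) ?_ ?_ ?_ ?_ ?_
  · intro b hb
    simp only [Finset.mem_filter, Finset.mem_range] at hb ⊢
    refine ⟨Nat.mul_lt_mul_of_pos_left hb.1 hd0, ?_⟩
    rw [Nat.gcd_mul_left, Nat.gcd_comm, hb.2.gcd_eq_one, mul_one]
  · intro a ha
    simp only [Finset.mem_filter, Finset.mem_range] at ha ⊢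
    obtain ⟨b, rfl⟩ : d ∣ a := by
      have := Nat.gcd_dvd_right (d * e) a
      rwa [ha.2] at this
    rw [Nat.mul_div_cancel_left b hd0]
    refine ⟨lt_of_mul_lt_mul_left ha.1 hd0.le, ?_⟩
    have := ha.2
    rw [Nat.gcd_mul_left] at this
    rw [Nat.coprime_comm]
    exact Nat.eq_of_mul_eq_mul_left hd0 (by rw [this, mul_one])
  · intro b _
    exact Nat.mul_div_cancel_left b hd0
  · intro a ha
    simp only [Finset.mem_filter] at ha
    refine Nat.mul_div_cancel' ?_
    have := Nat.gcd_dvd_right (d * e) a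
    rwa [ha.2] at this
  · intro b _
    have hd' : (d : ℂ) ≠ 0 := by exact_mod_cast hd0.ne'
    push_cast
    rw [mul_assoc (d : ℂ), mul_div_mul_left _ _ hd']

theorem sum_divisors_ramanujanProd {q : ℕ} (hq : Squarefree q) (n : ℕ) :
    ∑ d ∈ q.divisors, ramanujanProd d.primeFactors n = if q ∣ n then (q : ℝ) else 0 := by
  set g : ℕ → ℝ := fun p => (if p ∣ n then (p : ℝ) else 0) - 1
  have hg : ∀ d : ℕ, d ≠ 0 →
      ArithmeticFunction.prodPrimeFactors g d = ramanujanProd d.primeFactors n := fun d hd =>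
    ArithmeticFunction.prodPrimeFactors_apply hd
  have h := ArithmeticFunction.IsMultiplicative.prodPrimeFactors_one_add_of_squarefree
    (ArithmeticFunction.IsMultiplicative.prodPrimeFactors g) hq
  have e1 : ∑ d ∈ q.divisors, ramanujanProd d.primeFactors n =
      ∑ d ∈ q.divisors, ArithmeticFunction.prodPrimeFactors g d :=
    Finset.sum_congr rfl fun d hd => (hg d (Nat.pos_of_mem_divisors hd).ne').symm
  rw [e1, ← h]
  have e2 : ∀ p ∈ q.primeFactors, 1 + ArithmeticFunction.prodPrimeFactors g p =
      if p ∣ n then (p : ℝ) else 0 := fun p hp => by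
    have hp' := Nat.prime_of_mem_primeFactors hp
    rw [hg p hp'.ne_zero, hp'.primeFactors, ramanujanProd, Finset.prod_singleton]
    ring
  rw [Finset.prod_congr rfl e2]
  have hprod := Nat.prod_primeFactors_of_squarefree hq
  split_ifs with hd
  · conv_rhs => rw [← hprod]
    rw [Nat.cast_prod]
    exact Finset.prod_congr rfl fun p hp =>
      if_pos ((Nat.dvd_of_mem_primeFactors hp).trans hd)
  · by_contra hne
    refine hd ?_
    rw [← hprod]
    refine Finset.prod_primes_dvd n (fun p hp => (Nat.prime_of_mem_primeFactors hp).prime)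
      fun p hp => ?_
    by_contra hpn
    exact hne (Finset.prod_eq_zero hp (if_neg hpn))

/-- Both sides have the same sums over divisors of every squarefree modulus; strong induction plays
the role of Möbius inversion. -/
theorem ramanujanSum_eq_ramanujanProd {q : ℕ} (hq : Squarefree q) (n : ℕ) :
    ramanujanSum q n = (ramanujanProd q.primeFactors n : ℂ) := by
  induction q using Nat.strong_induction_on with
  | _ q ih =>
    have h1 := sum_divisors_ramanujanSum hq.ne_zero n
    have h2 := congrArg (fun x : ℝ => (x : ℂ)) (sum_divisors_ramanujanProd hq n)
    simp only [Complex.ofReal_sum] at h2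
    rw [← Nat.insert_self_properDivisors hq.ne_zero,
      Finset.sum_insert Nat.self_notMem_properDivisors] at h1 h2
    have h3 : ∑ d ∈ q.properDivisors, ramanujanSum d n =
        ∑ d ∈ q.properDivisors, (ramanujanProd d.primeFactors n : ℂ) :=
      Finset.sum_congr rfl fun d hd => by
        rw [Nat.mem_properDivisors] at hd
        exact ih d hd.2 (hq.squarefree_of_dvd hd.1)
    have h4 : (((if q ∣ n then (q : ℝ) else 0) : ℝ) : ℂ) = if q ∣ n then (q : ℂ) else 0 := by
      split_ifs <;> simp
    rw [h4, ← h1, h3] at h2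
    exact (add_right_cancel h2).symm

/-! ### Comparison of the arithmetic factors -/

/-- A prime `p ≥ A^(1/η)` has `A ≤ p^η`; the boundedly many smaller primes are absorbed into `D`. -/
theorem exists_prod_const_le_rpow {A η : ℝ} (hA : 1 ≤ A) (hη : 0 < η) :
    ∃ D : ℝ, 0 < D ∧ ∀ s : Finset ℕ, (∀ p ∈ s, p.Prime) →
      ∏ _p ∈ s, A ≤ D * ∏ p ∈ s, (p : ℝ) ^ η := by
  set Y : ℝ := A ^ (1 / η)
  have hA0 : 0 < A := by linarith
  refine ⟨A ^ ⌈Y⌉₊, by positivity, fun s hs => ?_⟩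
  have h1 : ∀ p ∈ s, A ≤ (if p < ⌈Y⌉₊ then A else 1) * (p : ℝ) ^ η := by
    intro p hp
    have hp1 : (1 : ℝ) ≤ p := by exact_mod_cast (hs p hp).one_le
    split_ifs with h
    · exact le_mul_of_one_le_right hA0.le (one_le_rpow hp1 hη.le)
    · rw [one_mul]
      have h2 : Y ≤ p := (Nat.le_ceil Y).trans (by exact_mod_cast not_lt.1 h)
      calc A = Y ^ η := by rw [← rpow_mul hA0.le, one_div_mul_cancel hη.ne', rpow_one]
        _ ≤ _ := rpow_le_rpow (by positivity) h2 hη.le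
  refine (Finset.prod_le_prod (fun _ _ => hA0.le) h1).trans ?_
  rw [Finset.prod_mul_distrib]
  refine mul_le_mul_of_nonneg_right ?_ (by positivity)
  rw [← Finset.prod_filter, Finset.prod_const]
  refine pow_le_pow_right₀ hA ?_
  calc (s.filter fun p => p < ⌈Y⌉₊).card ≤ (Finset.range ⌈Y⌉₊).card :=
        Finset.card_le_card fun p hp => Finset.mem_range.2 (Finset.mem_filter.1 hp).2
    _ = _ := Finset.card_range _

theorem totient_div_eq_prod {q : ℕ} (hq : q ≠ 0) :
    (q.totient : ℝ) / q = ∏ p ∈ q.primeFactors, (1 - 1 / (p : ℝ)) := by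
  have h := congrArg (fun x : ℚ => (x : ℝ)) (Nat.totient_eq_mul_prod_factors q)
  push_cast at h
  have hq0 : (q : ℝ) ≠ 0 := by exact_mod_cast hq
  rw [h, mul_div_cancel_left₀ _ hq0]
  exact Finset.prod_congr rfl fun p _ => by rw [one_div]

theorem divisorFn_eq_prod {q : ℕ} (hq : Squarefree q) (m : ℕ) :
    (divisorFn m q : ℝ) = ∏ _p ∈ q.primeFactors, (m : ℝ) := by
  rw [divisorFn, Nat.card_finMulAntidiag_of_squarefree hq, Finset.prod_const,
    ArithmeticFunction.cardDistinctFactors_apply]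
  push_cast
  rfl

/-- The local bound has exponent `m = k - 1`; one further factor `1 - 1/p ≤ 1` is given away at each
prime. -/
theorem divisorFn_mul_totient_div_pow_le {m q : ℕ} (hq : Squarefree q) :
    (divisorFn m q : ℝ) * ((q.totient : ℝ) / q) ^ (m + 1) ≤
      ∏ p ∈ q.primeFactors, PowerSeries.coeff 0 (localSeries (m + 1) p) := by
  rw [divisorFn_eq_prod hq, totient_div_eq_prod hq.ne_zero, ← Finset.prod_pow,
    ← Finset.prod_mul_distrib]
  refine Finset.prod_le_prod (fun p hp => ?_) fun p hp => ?_
  · have := half_le_one_sub_one_div (Nat.prime_of_mem_primeFactors hp)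
    exact mul_nonneg (Nat.cast_nonneg _) (pow_nonneg (by linarith) _)
  · have hp' := Nat.prime_of_mem_primeFactors hp
    have h1 := half_le_one_sub_one_div hp'
    have h2 : 1 - 1 / (p : ℝ) ≤ 1 := by
      have : (0 : ℝ) ≤ 1 / p := by positivity
      linarith
    refine le_trans ?_ (le_coeff_zero_localSeries hp')
    exact mul_le_mul_of_nonneg_left
      (pow_le_pow_of_le_one (by linarith) h2 (Nat.le_succ m)) (Nat.cast_nonneg _)

/-- The error factor is negligible compared with the main factor. -/
theorem exists_prod_error_le {m : ℕ} (hm : 1 ≤ m) {η : ℝ} (hη : 0 < η) :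
    ∃ D : ℝ, 0 < D ∧ ∀ q : ℕ, Squarefree q → ∀ N : ℝ, 1 ≤ N → (q : ℝ) ≤ N ^ ((1 : ℝ) / 2) →
      (∏ p ∈ q.primeFactors, (1 + 2 ^ (m + 1) * (p : ℝ) ^ η)) * N ^ (1 - η) ≤
        (∏ p ∈ q.primeFactors, PowerSeries.coeff 0 (localSeries (m + 1) p)) *
          (D * N ^ (1 - η / 4)) := by
  -- The factor `2^m` compensates for dividing by the local constant term, which is at least
  -- `2^(-m)`; `2^(m+2)` comes from `1 + 2^(m+1) p^η ≤ 2^(m+2) p^η`.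
  obtain ⟨D, hD, H⟩ := exists_prod_const_le_rpow (A := (2 : ℝ) ^ m * 2 ^ (m + 2))
    (one_le_mul_of_one_le_of_one_le (one_le_pow₀ (by norm_num)) (one_le_pow₀ (by norm_num)))
    (half_pos hη)
  refine ⟨D, hD, fun q hq N hN hqN => ?_⟩
  have hN0 : 0 < N := by linarith
  set s := q.primeFactors
  have hs : ∀ p ∈ s, p.Prime := fun p hp => Nat.prime_of_mem_primeFactors hp
  have hpow : ∀ θ : ℝ, ∏ p ∈ s, (p : ℝ) ^ θ = (q : ℝ) ^ θ := fun θ => by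
    rw [finsetProd_rpow _ _ fun p _ => Nat.cast_nonneg p, ← Nat.cast_prod,
      Nat.prod_primeFactors_of_squarefree hq]
  have hterm : ∀ p ∈ s, 1 + 2 ^ (m + 1) * (p : ℝ) ^ η ≤
      PowerSeries.coeff 0 (localSeries (m + 1) p) * (2 ^ m * 2 ^ (m + 2) * (p : ℝ) ^ η) := by
    intro p hp
    have hp1 : (1 : ℝ) ≤ p := by exact_mod_cast (hs p hp).one_le
    have h1 : 1 ≤ (p : ℝ) ^ η := one_le_rpow hp1 hη.le
    have h2 : (1 : ℝ) ≤ 2 ^ (m + 1) := one_le_pow₀ (by norm_num)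
    have h3 := half_pow_le_coeff_zero_localSeries hm (hs p hp)
    have h4 : (1 / 2 : ℝ) ^ m * 2 ^ m = 1 := by rw [← mul_pow]; norm_num
    calc 1 + 2 ^ (m + 1) * (p : ℝ) ^ η ≤ 2 ^ (m + 2) * (p : ℝ) ^ η := by
          rw [pow_succ 2 (m + 1)]; nlinarith
      _ = (1 / 2 : ℝ) ^ m * (2 ^ m * 2 ^ (m + 2) * (p : ℝ) ^ η) := by
          rw [← mul_assoc, ← mul_assoc, h4, one_mul]
      _ ≤ _ := mul_le_mul_of_nonneg_right h3 (by positivity)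
  have hpos : 0 < ∏ p ∈ s, PowerSeries.coeff 0 (localSeries (m + 1) p) :=
    Finset.prod_pos fun p hp => coeff_zero_localSeries_pos hm (hs p hp)
  calc (∏ p ∈ s, (1 + 2 ^ (m + 1) * (p : ℝ) ^ η)) * N ^ (1 - η)
      ≤ (∏ p ∈ s, PowerSeries.coeff 0 (localSeries (m + 1) p) *
          (2 ^ m * 2 ^ (m + 2) * (p : ℝ) ^ η)) * N ^ (1 - η) := by
        refine mul_le_mul_of_nonneg_right (Finset.prod_le_prod (fun p _ => by positivity) hterm)
          (by positivity)
    _ = (∏ p ∈ s, PowerSeries.coeff 0 (localSeries (m + 1) p)) *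
          ((∏ _p ∈ s, (2 : ℝ) ^ m * 2 ^ (m + 2)) * (q : ℝ) ^ η * N ^ (1 - η)) := by
        rw [Finset.prod_mul_distrib, Finset.prod_mul_distrib, hpow]; ring
    _ ≤ _ := by
        refine mul_le_mul_of_nonneg_left ?_ hpos.le
        have h5 := H s hs
        rw [hpow] at h5
        have hqpos : (0 : ℝ) < q := by exact_mod_cast Nat.pos_of_ne_zero hq.ne_zero
        calc (∏ _p ∈ s, (2 : ℝ) ^ m * 2 ^ (m + 2)) * (q : ℝ) ^ η * N ^ (1 - η)
            ≤ (D * (q : ℝ) ^ (η / 2)) * (q : ℝ) ^ η * N ^ (1 - η) := by gcongr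
          _ = D * ((q : ℝ) ^ (η / 2 + η) * N ^ (1 - η)) := by rw [rpow_add hqpos]; ring
          -- The exponents add up to `(1/2)(3η/2) + 1 - η = 1 - η/4`.
          _ ≤ D * ((N ^ ((1 : ℝ) / 2)) ^ (η / 2 + η) * N ^ (1 - η)) := by gcongr
          _ = _ := by
              rw [← rpow_mul hN0.le, ← rpow_add hN0]
              ring_nf

/-! ### The lower bound -/

/-- The top coefficient of `Q` meets the coefficient of `A` of size `L^m`; all lower ones contribute
`O(L^(m-1))`, with a constant that may depend on `Q`. -/
theorem diffPairing_ge {m : ℕ} (hm : 1 ≤ m) {Q : Polynomial ℝ} {A : PowerSeries ℝ}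
    {a M h L : ℝ} (ha : 0 ≤ a) (hM : 0 ≤ M) (hh : 0 ≤ h) (hL : 1 ≤ L) {c : ℝ} (hc : 0 ≤ c)
    (hQ : c ≤ Q.coeff m)
    (h1 : a / m.factorial * h * L ^ m ≤ PowerSeries.coeff m A)
    (h2 : ∀ i ≤ m, |PowerSeries.coeff i A| ≤ M * h * L ^ i) :
    c * a * h * L ^ m - M * (∑ i ∈ Finset.range m, i.factorial * |Q.coeff i|) * h * L ^ (m - 1) ≤
      diffPairing m Q A := by
  rw [diffPairing, Finset.sum_range_succ]
  have e1 : c * a * h * L ^ m ≤ m.factorial * PowerSeries.coeff m A * Q.coeff m := by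
    have hf : (0 : ℝ) < m.factorial := by exact_mod_cast m.factorial_pos
    have h3 : a * h * L ^ m ≤ m.factorial * PowerSeries.coeff m A := by
      calc a * h * L ^ m = m.factorial * (a / m.factorial * h * L ^ m) := by field_simp
        _ ≤ _ := mul_le_mul_of_nonneg_left h1 hf.le
    have h4 : 0 ≤ a * h * L ^ m := by positivity
    calc c * a * h * L ^ m = (a * h * L ^ m) * c := by ring
      _ ≤ _ := mul_le_mul h3 hQ hc (h4.trans h3)
  have e2 : -(M * (∑ i ∈ Finset.range m, i.factorial * |Q.coeff i|) * h * L ^ (m - 1)) ≤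
      ∑ i ∈ Finset.range m, i.factorial * PowerSeries.coeff i A * Q.coeff i := by
    rw [Finset.mul_sum, Finset.sum_mul, Finset.sum_mul, ← Finset.sum_neg_distrib]
    refine Finset.sum_le_sum fun i hi => ?_
    have hi' := Finset.mem_range.1 hi
    have h3 : |(i.factorial : ℝ) * PowerSeries.coeff i A * Q.coeff i| ≤
        M * (i.factorial * |Q.coeff i|) * h * L ^ (m - 1) := by
      rw [abs_mul, abs_mul, Nat.abs_cast]
      calc (i.factorial : ℝ) * |PowerSeries.coeff i A| * |Q.coeff i|
          ≤ i.factorial * (M * h * L ^ (m - 1)) * |Q.coeff i| := by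
            gcongr
            refine (h2 i hi'.le).trans ?_
            gcongr
            omega
        _ = _ := by ring
    exact (abs_le.1 h3).1
  linarith

theorem lemma8p2 (k : ℕ) (hk : 2 ≤ k) (δ : ℝ) (hδ : 0 < δ) :
    ∃ c : ℝ, 0 < c ∧ ∃ C : ℝ, 0 < C ∧
      ∀ ε : ℝ, 0 < ε → ε ≤ 1 / 2 → ∀ Φ : ℝ → ℝ, IsSmoothCutoff ε Φ →
        ∃ N₀ : ℕ, ∀ N : ℕ, N₀ ≤ N → ∀ q : ℕ,
          Squarefree q →
          (q : ℝ) ≤ (N : ℝ) ^ ((1 : ℝ) / 2 - δ / 2) →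
          (∀ p : ℕ, p.Prime → p ∣ q → (p : ℝ) < (N : ℝ) ^ c) →
          C * ((divisorFn (k - 1) q : ℝ) * ((Nat.totient q : ℝ) / (q : ℝ)) ^ k *
              (N : ℝ) * Real.log (N : ℝ) ^ (k - 1)) ≤
            ‖∑ n ∈ Finset.Icc 1 N,
              (divisorFn k n : ℂ) * ((Φ ((n : ℝ) / (N : ℝ)) : ℝ) : ℂ) * ramanujanSum q n‖ := by
  obtain ⟨m, rfl⟩ : ∃ m, k = m + 1 := ⟨k - 1, by omega⟩
  have hm : 1 ≤ m := by omega
  obtain ⟨c₀, hc₀, hsmooth⟩ := exists_smooth_summatory_zetaPow_asymptotic hm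
  obtain ⟨c, hc, M, hM, hseries⟩ := exists_coeff_prod_localSeries_bounds hm hδ
  set a : ℝ := δ ^ m / 2
  have ha : 0 < a := by positivity
  -- The main term has constant `c₀ a`; the lower coefficients of `Q` and the power-saving error
  -- each take at most `c₀ a / 4`.
  refine ⟨c, hc, c₀ * a / 2, by positivity, fun ε _ hε Φ hΦ => ?_⟩
  obtain ⟨Q, hQdeg, hQ, η, hη, hη1, B, hB, hasym⟩ := hsmooth ε hε Φ hΦ
  obtain ⟨D, hD, herr⟩ := exists_prod_error_le hm hη
  set K := ∑ i ∈ Finset.range m, (i.factorial : ℝ) * |Q.coeff i|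
  have hK : 0 ≤ K := Finset.sum_nonneg fun _ _ => by positivity
  have hlogN : Tendsto (fun N : ℕ => log (N : ℝ)) atTop atTop :=
    tendsto_log_atTop.comp tendsto_natCast_atTop_atTop
  have hpowN : Tendsto (fun N : ℕ => B * D * (N : ℝ) ^ (-(η / 4))) atTop (𝓝 0) := by
    have := ((tendsto_rpow_neg_atTop (by positivity : 0 < η / 4)).comp
      tendsto_natCast_atTop_atTop).const_mul (B * D)
    simpa using this
  -- The dependence on `Φ`, through `K`, `B`, `D` and `η`, is confined to this threshold.
  obtain ⟨N₀, hN₀⟩ := eventually_atTop.1 ((hlogN.eventually_ge_atTop 1).and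
    ((hlogN.eventually_ge_atTop (M * K / (c₀ * a / 4))).and
    (hpowN.eventually_le_const (by positivity : 0 < c₀ * a / 4))))
  refine ⟨N₀, fun N hN q hq hqN hpN => ?_⟩
  obtain ⟨hL1, hLK, hBD⟩ := hN₀ N hN
  set L := log (N : ℝ)
  have hN1 : (1 : ℝ) ≤ N := by
    rcases Nat.eq_zero_or_pos N with rfl | h
    · simp [L] at hL1; linarith
    · exact_mod_cast h
  have hN0 : (0 : ℝ) < N := by linarith
  have hL0 : 0 < L := by linarith
  set s := q.primeFactors
  have hs : ∀ p ∈ s, p.Prime := fun p hp => Nat.prime_of_mem_primeFactors hp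
  set h := ∏ p ∈ s, PowerSeries.coeff 0 (localSeries (m + 1) p)
  have hh : 0 < h := Finset.prod_pos fun p hp => coeff_zero_localSeries_pos hm (hs p hp)
  have hqpos : (0 : ℝ) < q := by exact_mod_cast Nat.pos_of_ne_zero hq.ne_zero
  have hlogp : ∀ p ∈ s, log p ≤ c * L := fun p hp => by
    have := hpN p (hs p hp) (Nat.dvd_of_mem_primeFactors hp)
    rw [← log_rpow hN0]
    exact log_le_log (by exact_mod_cast (hs p hp).pos) this.le
  have hlogq : ∑ p ∈ s, log p ≤ (1 / 2 - δ / 2) * L := by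
    have e : ∑ p ∈ s, log (p : ℝ) = log q := by
      rw [← log_prod fun p hp => by exact_mod_cast (hs p hp).ne_zero, ← Nat.cast_prod,
        Nat.prod_primeFactors_of_squarefree hq]
    rw [e, ← log_rpow hN0]
    exact log_le_log hqpos hqN
  obtain ⟨hlead, hcoef⟩ := hseries s hs L hL0 hlogp hlogq
  set A := (∏ p ∈ s, PowerSeries.rescale (log p) (localSeries (m + 1) p)) * expSeries L
  have hpair := diffPairing_ge hm ha.le hM hh.le hL1 hc₀.le hQ
    (by rw [show a / m.factorial = δ ^ m / (2 * m.factorial) by simp only [a]; field_simp]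
        exact hlead) hcoef
  have hlow : M * K * h * L ^ (m - 1) ≤ c₀ * a / 4 * h * L ^ m := by
    have h1 : M * K ≤ c₀ * a / 4 * L := by
      rw [div_le_iff₀ (by positivity)] at hLK; linarith
    calc M * K * h * L ^ (m - 1) ≤ (c₀ * a / 4 * L) * h * L ^ (m - 1) := by gcongr
      _ = c₀ * a / 4 * h * (L ^ (m - 1) * L) := by ring
      _ = _ := by rw [← pow_succ, Nat.sub_add_cancel hm]
  have hW := abs_summatory_ramanujanProd_sub_le (k := m + 1) (Φ := Φ) hQdeg hη1 hB hasym s hs N hN0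
  set W := summatory (fun n => zetaPow (m + 1) n * ramanujanProd s n * Φ (n / N)) N
  have herr' : B * (∏ p ∈ s, (1 + 2 ^ (m + 1) * (p : ℝ) ^ η)) * (N : ℝ) ^ (1 - η) ≤
      c₀ * a / 4 * h * N * L ^ m := by
    have h1 := herr q hq N hN1 (hqN.trans (rpow_le_rpow_of_exponent_le hN1 (by linarith)))
    calc B * (∏ p ∈ s, (1 + 2 ^ (m + 1) * (p : ℝ) ^ η)) * (N : ℝ) ^ (1 - η)
        ≤ B * (h * (D * (N : ℝ) ^ (1 - η / 4))) := by
          rw [mul_assoc]; exact mul_le_mul_of_nonneg_left h1 hB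
      _ = (B * D * (N : ℝ) ^ (-(η / 4))) * h * N := by
          rw [sub_eq_add_neg, rpow_add hN0, rpow_one]; ring
      _ ≤ c₀ * a / 4 * h * N := by gcongr
      _ ≤ _ := le_mul_of_one_le_right (by positivity) (one_le_pow₀ hL1)
  have hsum : ∑ n ∈ Finset.Icc 1 N, (divisorFn (m + 1) n : ℂ) *
      ((Φ ((n : ℝ) / (N : ℝ)) : ℝ) : ℂ) * ramanujanSum q n = (W : ℂ) := by
    simp only [W, summatory, Nat.floor_natCast, Complex.ofReal_sum]
    refine Finset.sum_congr rfl fun n _ => ?_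
    rw [ramanujanSum_eq_ramanujanProd hq, zetaPow_apply]
    push_cast
    ring
  rw [hsum, Complex.norm_real, norm_eq_abs, Nat.add_sub_cancel]
  refine le_trans ?_ (le_abs_self W)
  have h2 := (abs_le.1 (hW.trans herr')).1
  have h3 : c₀ * a * h * L ^ m - c₀ * a / 4 * h * L ^ m ≤ diffPairing m Q A := by linarith
  have h4 := mul_le_mul_of_nonneg_left h3 hN0.le
  have h5 := divisorFn_mul_totient_div_pow_le (m := m) hq
  calc c₀ * a / 2 * ((divisorFn m q : ℝ) * ((Nat.totient q : ℝ) / q) ^ (m + 1) * N * L ^ m)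
      ≤ c₀ * a / 2 * (h * N * L ^ m) := by gcongr
    _ ≤ W := by linarith
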